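/- Consider an expanding, non-tilted, spatially homogeneous cosmology of Bianchi type VIII whose source is a perfect fluid with energy density $\mu>0$ and pressure $p=(\gamma-1)\mu$, where $1\le\gamma\le 2$. That is, there are left-invariant vector fields with $[X_1,X_2]=-X_0$, $[X_2,X_0]=X_1$, $[X_0,X_1]=X_2$ and dual one-forms $\omega^i$, and, relative to a diagonalizing basis of this kind, the metric $$ds^2=-dt^2+\sum_{i=0}^{2}a_i^2\,(\omega^i)^2=-H^{-2}d\tau^2+\sum_{i=0}^{2}a_i^2\,(\omega^i)^2$$ satisfies Einstein's equations $G_{ab}=\mu u_au_b+p\,(g_{ab}+u_au_b)$ (units $8\pi G=c=1$, no cosmological constant) with $u=\partial/\partial t$. Here $\ell=(a_0a_1a_2)^{1/3}$ is the length scale, $H=\dot\ell/\ell>0$ is the Hubble scalar (the dot is $d/dt$), and the dimensionless time $\tau$ is defined by $\ell=\ell_0e^{\tau}$, so that $dt/d\tau=1/H$; all quantities are functions of $\tau\in(\tau_0,\infty)$. Let $\sigma_{ab}$ be the rate-of-shear tensor of $u$, let $E_{ab}$ and $H_{ab}$ be the electric and magnetic parts of the Weyl tensor relative to $u$, and define $\Omega=\mu/(3H^2)$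 and the nonnegative scalars $\Sigma$, $\mathcal W$ by $$\Sigma^2=\frac{\sigma_{ab}\sigma^{ab}}{6H^2},\qquad \mathcal W^2=\frac{E_{ab}E^{ab}+H_{ab}H^{ab}}{6H^4}.$$ In the orthonormal frame $e_0=u$, $e_{i+1}=a_i^{-1}X_i$, put $n_2=a_1/(a_2a_0)$, $n_3=a_2/(a_0a_1)$, $\Sigma_-=(\sigma_{22}-\sigma_{33})/(2\sqrt3H)$ and $N_-=(n_2-n_3)/(2\sqrt3H)$. The model is called locally rotationally symmetric (LRS) if $\Sigma_-=N_-=0$ for all $\tau$. Then $$\lim_{\tau\to+\infty}\Sigma=\tfrac12,\qquad \lim_{\tau\to+\infty}\Omega=0,$$ $$\lim_{\tau\to+\infty}\mathcal W=+\infty\ \text{ if the model is not LRS},\qquad \lim_{\tau\to+\infty}\mathcal W=0\ \text{ if the model is LRS}.$$ -/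

import Mathlib

open Filter Topology

noncomputable section

/-- The totally antisymmetric symbol on four indices, `eps4 0 1 2 3 = 1`. -/
def eps4 (a b c d : Fin 4) : ℝ :=
  ((b : ℝ) - (a : ℝ)) * ((c : ℝ) - (a : ℝ)) * ((d : ℝ) - (a : ℝ)) *
    ((c : ℝ) - (b : ℝ)) * ((d : ℝ) - (b : ℝ)) * ((d : ℝ) - (c : ℝ)) / 12

/-- The components of the metric (and of its inverse) in an orthonormal frame whose vector `e₀` is
timelike: `diag(-1, 1, 1, 1)`. -/
def minkowski (a b : Fin 4) : ℝ := if a = b then (if a = 0 then -1 else 1) else 0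

/-- A spatially homogeneous spacetime of Bianchi type VIII, expanding, described in a
group-invariant frame in which its metric is diagonal. All functions are functions of the
dimensionless time `τ ∈ (τ₀, ∞)`, which is related to the clock time `t` along the normal
congruence by `dt/dτ = 1/H`. The symmetry group has a basis `X₀, X₁, X₂` of left-invariant vector
fields with `[X₁, X₂] = -X₀`, `[X₂, X₀] = X₁`, `[X₀, X₁] = X₂` (the Lie algebra
`so(2,1) ≅ sl(2,ℝ)`); with `ωⁱ` the dual one-forms, the metric is `-dt² + ∑ᵢ aᵢ² (ωⁱ)² = -H⁻² dτ² + ∑ᵢ aᵢ² (ωⁱ)²`. -/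
structure BianchiVIIISpacetime where
  /-- the beginning of the time interval -/
  τ₀ : ℝ
  /-- the length scale at `τ = 0` -/
  ℓ₀ : ℝ
  /-- the Hubble scalar -/
  H : ℝ → ℝ
  /-- the scale factors -/
  a : Fin 3 → ℝ → ℝ
  ℓ₀_pos : 0 < ℓ₀
  H_pos : ∀ τ, τ₀ < τ → 0 < H τ
  a_pos : ∀ i τ, τ₀ < τ → 0 < a i τ
  H_smooth : ContDiffOn ℝ 1 H (Set.Ioi τ₀)
  a_smooth : ∀ i, ContDiffOn ℝ 2 (a i) (Set.Ioi τ₀)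
  /-- the overall length scale `ℓ = (a₀ a₁ a₂)^{1/3}` is `ℓ₀ e^τ`; together with `dt/dτ = 1/H` this
  says that `H` is the logarithmic derivative of `ℓ` with respect to clock time -/
  length_scale : ∀ τ, τ₀ < τ → a 0 τ * a 1 τ * a 2 τ = (ℓ₀ * Real.exp τ) ^ 3

namespace BianchiVIIISpacetime

variable (S : BianchiVIIISpacetime)

/-! ### The orthonormal frame

The orthonormal frame is `e 0 = ∂/∂t = H ∂/∂τ`, the unit normal of the group orbits, and
`e (i + 1) = X i / a i`. It acts on functions that are constant on the group orbits, that is, on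
functions of `τ`. -/

/-- The derivative `e_c f` of a group-invariant function `f` along a frame vector. -/
def frameDeriv (c : Fin 4) (f : ℝ → ℝ) (τ : ℝ) : ℝ :=
  if c = 0 then S.H τ * deriv f τ else 0

/-- The rate of expansion `(da_i/dt) / a_i` along the `i`-th spatial axis. -/
def axisRate (i : Fin 3) (τ : ℝ) : ℝ := S.H τ * deriv (S.a i) τ / S.a i τ

/-- The commutation functions `γ^a_{bc}` of the frame: `[e_b, e_c] = ∑ₐ γ^a_{bc} e_a`. They are
those of `[e 0, e (i+1)] = [H ∂/∂τ, X i / a i] = -(axisRate i) e (i+1)` and of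
`[e (i+1), e (j+1)] = [X i, X j] / (a i * a j)`. -/
def comm (a b c : Fin 4) (τ : ℝ) : ℝ :=
  match a, b, c with
  | 1, 0, 1 => -S.axisRate 0 τ
  | 1, 1, 0 => S.axisRate 0 τ
  | 2, 0, 2 => -S.axisRate 1 τ
  | 2, 2, 0 => S.axisRate 1 τ
  | 3, 0, 3 => -S.axisRate 2 τ
  | 3, 3, 0 => S.axisRate 2 τ
  | 1, 2, 3 => -(S.a 0 τ / (S.a 1 τ * S.a 2 τ))
  | 1, 3, 2 => S.a 0 τ / (S.a 1 τ * S.a 2 τ)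
  | 2, 3, 1 => S.a 1 τ / (S.a 2 τ * S.a 0 τ)
  | 2, 1, 3 => -(S.a 1 τ / (S.a 2 τ * S.a 0 τ))
  | 3, 1, 2 => S.a 2 τ / (S.a 0 τ * S.a 1 τ)
  | 3, 2, 1 => -(S.a 2 τ / (S.a 0 τ * S.a 1 τ))
  | _, _, _ => 0

/-- The commutation functions with the first index lowered, `g([e_b, e_c], e_a)`. -/
def commLow (a b c : Fin 4) (τ : ℝ) : ℝ := minkowski a a * S.comm a b c τ

/-- The Levi-Civita connection `g(∇_{e_b} e_c, e_a)`, by the Koszul formula. -/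
def connLow (a b c : Fin 4) (τ : ℝ) : ℝ :=
  (S.commLow a b c τ - S.commLow b c a τ + S.commLow c a b τ) / 2

/-- The Levi-Civita connection coefficients: `∇_{e_b} e_c = ∑ₐ Γ^a_{bc} e_a`. -/
def conn (a b c : Fin 4) (τ : ℝ) : ℝ := minkowski a a * S.connLow a b c τ

/-! ### Curvature -/

/-- The Riemann tensor: `∑ₐ R^a_{bcd} e_a = ∇_c ∇_d e_b - ∇_d ∇_c e_b - ∇_{[e_c, e_d]} e_b`. -/
def riemann (a b c d : Fin 4) (τ : ℝ) : ℝ :=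
  S.frameDeriv c (S.conn a d b) τ - S.frameDeriv d (S.conn a c b) τ
    + ∑ f, (S.conn f d b τ * S.conn a c f τ - S.conn f c b τ * S.conn a d f τ
      - S.comm f c d τ * S.conn a f b τ)

/-- The Ricci tensor `R_{bd} = R^a_{bad}`. -/
def ricci (b d : Fin 4) (τ : ℝ) : ℝ := ∑ a, S.riemann a b a d τ

/-- The scalar curvature. -/
def scalarCurv (τ : ℝ) : ℝ := ∑ b, minkowski b b * S.ricci b b τ

/-- The Einstein tensor `G_{ab} = R_{ab} - ½ R g_{ab}`. -/
def einstein (a b : Fin 4) (τ : ℝ) : ℝ :=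
  S.ricci a b τ - S.scalarCurv τ / 2 * minkowski a b

/-- The Weyl tensor `C_{abcd}`. -/
def weyl (a b c d : Fin 4) (τ : ℝ) : ℝ :=
  minkowski a a * S.riemann a b c d τ
    - (minkowski a c * S.ricci b d τ - minkowski a d * S.ricci b c τ
      - minkowski b c * S.ricci a d τ + minkowski b d * S.ricci a c τ) / 2
    + S.scalarCurv τ / 6 * (minkowski a c * minkowski b d - minkowski a d * minkowski b c)

/-- The dual `*C_{abcd} = ½ ε_{ab}^{ef} C_{efcd}` of the Weyl tensor. -/
def dualWeyl (a b c d : Fin 4) (τ : ℝ) : ℝ :=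
  (∑ e, ∑ f, eps4 a b e f * minkowski e e * minkowski f f * S.weyl e f c d τ) / 2

/-- The electric part `E_{ab} = C_{acbd} u^c u^d` of the Weyl tensor relative to `u = e 0`. -/
def electric (a b : Fin 4) (τ : ℝ) : ℝ := S.weyl a 0 b 0 τ

/-- The magnetic part `H_{ab} = *C_{acbd} u^c u^d` of the Weyl tensor relative to `u = e 0`. -/
def magnetic (a b : Fin 4) (τ : ℝ) : ℝ := S.dualWeyl a 0 b 0 τ

/-! ### Kinematics of the congruence `u = e 0` -/

/-- The covariant derivative `∇_b u_a = g(∇_{e_b} u, e_a)`. -/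
def gradU (a b : Fin 4) (τ : ℝ) : ℝ := S.connLow a b 0 τ

/-- The rate of volume expansion `Θ = ∇_a u^a`. -/
def expansion (τ : ℝ) : ℝ := ∑ a, minkowski a a * S.gradU a a τ

/-- The projection `h_{ab} = g_{ab} + u_a u_b` orthogonal to `u`. -/
def proj (a b : Fin 4) : ℝ := minkowski a b + (if a = 0 ∧ b = 0 then 1 else 0)

/-- The rate-of-shear tensor `σ_{ab} = h_a^c h_b^d ∇_{(c} u_{d)} - ⅓ Θ h_{ab}`. The matrix `h` is
diagonal in the frame. -/
def shear (a b : Fin 4) (τ : ℝ) : ℝ :=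
  proj a a * proj b b * ((S.gradU a b τ + S.gradU b a τ) / 2) - S.expansion τ / 3 * proj a b

/-! ### The matter source -/

/-- Einstein's field equations `G_{ab} = T_{ab}` (units with `8πG = c = 1`, no cosmological
constant) hold for a non-tilted perfect fluid, that is, with 4-velocity `u = e 0`, of energy density
`μ` and pressure `p = (γ - 1) μ`: `T_{ab} = μ u_a u_b + p h_{ab}`. -/
def IsPerfectFluid (γ : ℝ) (μ : ℝ → ℝ) : Prop :=
  ∀ τ, S.τ₀ < τ → ∀ a b : Fin 4,
    S.einstein a b τ = μ τ * (if a = 0 ∧ b = 0 then 1 else 0) + (γ - 1) * μ τ * proj a b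

/-! ### Hubble-normalized quantities -/

/-- `Σ₋ = (σ₂₂ - σ₃₃) / (2 √3 H)`. -/
def sigmaMinus (τ : ℝ) : ℝ := (S.shear 2 2 τ - S.shear 3 3 τ) / (2 * √3 * S.H τ)

/-- `N₋ = (n₂ - n₃) / (2 √3 H)`, where `n₂ = γ²₃₁` and `n₃ = γ³₁₂` are the commutation functions
of the spatial frame. -/
def NMinus (τ : ℝ) : ℝ := (S.comm 2 3 1 τ - S.comm 3 1 2 τ) / (2 * √3 * S.H τ)

/-- The model is locally rotationally symmetric: `Σ₋ = N₋ = 0`. -/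
def IsLRS : Prop := ∀ τ, S.τ₀ < τ → S.sigmaMinus τ = 0 ∧ S.NMinus τ = 0

/-- The density parameter `Ω = μ / (3 H²)`. -/
def densityParameter (μ : ℝ → ℝ) (τ : ℝ) : ℝ := μ τ / (3 * S.H τ ^ 2)

/-- The shear parameter `Σ ≥ 0`, with `Σ² = σ_{ab} σ^{ab} / (6 H²)`. -/
def shearParameter (τ : ℝ) : ℝ :=
  √((∑ a, ∑ b, minkowski a a * minkowski b b * S.shear a b τ ^ 2) / (6 * S.H τ ^ 2))

/-- The Weyl curvature parameter `W ≥ 0`, with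
`W² = (E_{ab} E^{ab} + H_{ab} H^{ab}) / (6 H⁴)`. -/
def weylParameter (τ : ℝ) : ℝ :=
  √((∑ a, ∑ b, minkowski a a * minkowski b b * (S.electric a b τ ^ 2 + S.magnetic a b τ ^ 2))
    / (6 * S.H τ ^ 4))

end BianchiVIIISpacetime

end

/-!
The spacetime is reduced to an ordinary differential equation for the Hubble-normalized variables
`X = Σ₊`, `s = √3 Σ₋`, `m = √3 N₋`, `P = N₊`, `n = -N₁` and `Ω`, all of which except `P` are bounded
by the Hamiltonian constraint. Late in time `P` grows exponentially, so that `(s, m)` rotates ever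
faster, and the argument is one of averaging: the product `c = s m / P` is of order `1 / P`, while
`c'` is `2 (s² - m²)` up to terms of order `c` and `1 / P`. Adding a multiple of `c` to a function
therefore replaces `s² - m²` in its derivative by the mean value zero.

* With this correction, `X - c / 2` grows at a definite rate whenever the deceleration parameter
  `q` is small. Since `log (n (P² - m²))` grows at the rate `3 q`, the variable `P` is bounded below
  by an exponential (`exists_exp_le_P`), and `1 / P` is integrable.
* The function `n (P² - m²)^{1/2} / (1 - X / 2)²` is increasing up to the correction and an
  integrable error; the derivative of its corrected logarithm is
  `((1 - 2 X)² + 3 (γ - 1) Ω + n² / 4) / (1 - X / 2)`, and the logarithm is bounded above. Hence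
  `X → 1/2`, and `Ω → 0` if `γ > 1` (`tendsto_sq_add_Ω`).
* Once `X → 1/2`, the derivative of `c / 4 - X` is `(s² + m²) / 2 + (3/4) (2 - γ) Ω` up to terms
  that tend to zero, and this nonnegative function, having a bounded derivative, has to tend to zero
  (`tendsto_shear_add_Ω`). This gives the limits of the shear and, if `γ < 2`, of `Ω`.
* The corrected `s² + m²` has a logarithmic rate that tends to `2 q - 2 + 2 X = 0`, while `P` has
  the rate `q + 2 X → 3/2`. So `P² (s² + m²) → ∞` unless `s = m = 0` identically
  (`tendsto_P_sq_mul`). The square of the Weyl parameter contains `(4/3) P² (s² + m²)`; the rest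
  cannot compensate it, since the other terms under the squares are bounded. When `s = m = 0`, what
  is left of the Weyl parameter tends to zero.
-/

noncomputable section

/-! ### Two facts on differentiable functions -/

/-- A differentiable function with nonnegative derivative on `[a, b]` has `f a ≤ f b`. -/
theorem le_of_hasDerivAt_nonneg {f f' : ℝ → ℝ} {a b : ℝ} (hab : a ≤ b)
    (h : ∀ t, a ≤ t → t ≤ b → HasDerivAt f (f' t) t) (h0 : ∀ t, a ≤ t → t ≤ b → 0 ≤ f' t) :
    f a ≤ f b := by
  refine monotoneOn_of_deriv_nonneg (convex_Icc a b)
    (fun t ht => (h t ht.1 ht.2).continuousAt.continuousWithinAt)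
    (fun t ht => ?_) (fun t ht => ?_) ⟨le_rfl, hab⟩ ⟨hab, le_rfl⟩ hab
  · rw [interior_Icc] at ht
    exact (h t ht.1.le ht.2.le).differentiableAt.differentiableWithinAt
  · rw [interior_Icc] at ht
    rw [(h t ht.1.le ht.2.le).deriv]
    exact h0 t ht.1.le ht.2.le

/-- A form of Barbalat's lemma: if `Y` converges and `f` is nonnegative with bounded derivative and
is at most `Y'` up to a term `g` that tends to zero, then `f` tends to zero. Otherwise `f` would
exceed `ε / 2` on intervals of a fixed length, arbitrarily late, on each of which `Y` would grow by
a fixed amount. -/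
theorem tendsto_zero_of_le_deriv_add {f f' g Y Y' : ℝ → ℝ} {T C l : ℝ}
    (hf : ∀ t, T < t → HasDerivAt f (f' t) t) (hC : ∀ t, T < t → |f' t| ≤ C)
    (hf0 : ∀ t, T < t → 0 ≤ f t) (hY : ∀ t, T < t → HasDerivAt Y (Y' t) t)
    (hYl : Tendsto Y atTop (𝓝 l)) (hg : Tendsto g atTop (𝓝 0))
    (h : ∀ t, T < t → f t ≤ Y' t + g t) : Tendsto f atTop (𝓝 0) := by
  have hC0 : 0 ≤ C := (abs_nonneg _).trans (hC (T + 1) (by linarith))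
  rw [Metric.tendsto_atTop]
  intro ε hε
  -- If `f t ≥ ε`, then `f ≥ 3ε/4` on `[t, t + δ]`, because `C δ < ε / 4`.
  set δ := ε / (4 * (C + 1)) with hδ
  have hδ0 : 0 < δ := by positivity
  have hCδ : (C + 1) * δ = ε / 4 := by rw [hδ]; field_simp
  have h1 : Tendsto (fun t => Y (t + δ) - Y t) atTop (𝓝 0) := by
    simpa using (hYl.comp (tendsto_atTop_add_const_right _ δ tendsto_id)).sub hYl
  obtain ⟨N, hN⟩ := eventually_atTop.1 (((h1.eventually_lt_const
    (show 0 < ε / 2 * δ by positivity)).and (eventually_gt_atTop T)))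
  obtain ⟨N', hN'⟩ := eventually_atTop.1 (hg.eventually_lt_const (show 0 < ε / 4 by positivity))
  refine ⟨max N N', fun t ht => ?_⟩
  obtain ⟨h2, hT⟩ := hN t (le_trans (le_max_left _ _) ht)
  rw [Real.dist_eq, sub_zero, abs_of_nonneg (hf0 t hT)]
  by_contra! hcon
  have h3 : ∀ u, t ≤ u → u ≤ t + δ → 3 * ε / 4 ≤ f u := by
    intro u hu hu'
    have := le_of_hasDerivAt_nonneg (f := fun v => f v + C * v) (f' := fun v => f' v + C) hu
      (fun v hv _ => ((hf v (hT.trans_le hv)).add ((hasDerivAt_id v).const_mul C)).congr_deriv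
        (by simp))
      (fun v hv _ => by linarith [(abs_le.1 (hC v (hT.trans_le hv))).1])
    nlinarith
  have h4 := le_of_hasDerivAt_nonneg (f := fun v => Y v - ε / 2 * v)
      (f' := fun v => Y' v - ε / 2) (show t ≤ t + δ by linarith)
      (fun v hv _ => ((hY v (hT.trans_le hv)).sub
        ((hasDerivAt_id v).const_mul (ε / 2))).congr_deriv (by simp))
      (fun v hv hv' => by
        have := h3 v hv hv'
        have := h v (hT.trans_le hv)
        have := hN' v ((le_max_right _ _).trans (ht.trans hv))
        linarith)
  linarith

/-! ### Functions bounded on a half-line -/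

/-- The function `f` is bounded on the open half-line `(T, ∞)`. -/
def BoundedAfter (T : ℝ) (f : ℝ → ℝ) : Prop := ∃ C, ∀ t, T < t → |f t| ≤ C

namespace BoundedAfter
variable {T : ℝ} {f g : ℝ → ℝ}

theorem const (T c : ℝ) : BoundedAfter T (fun _ => c) := ⟨|c|, fun _ _ => le_rfl⟩

theorem add (hf : BoundedAfter T f) (hg : BoundedAfter T g) :
    BoundedAfter T (fun t => f t + g t) := by
  obtain ⟨C, hC⟩ := hf
  obtain ⟨D, hD⟩ := hg
  exact ⟨C + D, fun t ht => (abs_add_le _ _).trans (add_le_add (hC t ht) (hD t ht))⟩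

theorem mul (hf : BoundedAfter T f) (hg : BoundedAfter T g) :
    BoundedAfter T (fun t => f t * g t) := by
  obtain ⟨C, hC⟩ := hf
  obtain ⟨D, hD⟩ := hg
  refine ⟨C * D, fun t ht => ?_⟩
  rw [abs_mul]
  exact mul_le_mul (hC t ht) (hD t ht) (abs_nonneg _) ((abs_nonneg _).trans (hC t ht))

theorem neg (hf : BoundedAfter T f) : BoundedAfter T (fun t => -f t) := by
  obtain ⟨C, hC⟩ := hf
  exact ⟨C, fun t ht => by rw [abs_neg]; exact hC t ht⟩

theorem sub (hf : BoundedAfter T f) (hg : BoundedAfter T g) :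
    BoundedAfter T (fun t => f t - g t) := by
  simpa [sub_eq_add_neg] using hf.add hg.neg

theorem pow (hf : BoundedAfter T f) (k : ℕ) : BoundedAfter T (fun t => f t ^ k) := by
  obtain ⟨C, hC⟩ := hf
  exact ⟨C ^ k, fun t ht => by rw [abs_pow]; exact pow_le_pow_left₀ (abs_nonneg _) (hC t ht) k⟩

theorem div_const (hf : BoundedAfter T f) (c : ℝ) : BoundedAfter T (fun t => f t / c) := by
  simpa [div_eq_mul_inv] using hf.mul (const T c⁻¹)

theorem tendsto_mul (hf : BoundedAfter T f) (hg : Tendsto g atTop (𝓝 0)) :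
    Tendsto (fun t => f t * g t) atTop (𝓝 0) := by
  obtain ⟨C, hC⟩ := hf
  refine squeeze_zero_norm' (a := fun t => C * |g t|) ?_ (by simpa using (hg.abs.const_mul C))
  filter_upwards [eventually_gt_atTop T] with t ht
  rw [norm_mul]
  exact mul_le_mul_of_nonneg_right (hC t ht) (abs_nonneg _)

end BoundedAfter

/-! ### The Hubble-normalized evolution equations -/

/-- A solution on `(τ₀, ∞)` of the Hubble-normalized Einstein equations for a non-tilted perfect
fluid of Bianchi type VIII with equation of state `p = (γ - 1) μ`. In place of `Σ₋` and `N₋` the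
variables `s = √3 Σ₋` and `m = √3 N₋` are used, which keeps the equations rational. The evolution
equation of `Ω` is not a field, since it follows from the constraint (`hasDerivAt_Ω`). -/
structure BianchiVIIIFlow (γ τ₀ : ℝ) where
  /-- the shear variable `Σ₊` -/
  X : ℝ → ℝ
  /-- the shear variable `√3 Σ₋` -/
  s : ℝ → ℝ
  /-- the spatial curvature variable `-N₁ > 0` -/
  n : ℝ → ℝ
  /-- the spatial curvature variable `N₊ = (N₂ + N₃) / 2` -/
  P : ℝ → ℝ
  /-- the spatial curvature variable `√3 N₋ = (N₂ - N₃) / 2` -/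
  m : ℝ → ℝ
  /-- the density parameter -/
  Ω : ℝ → ℝ
  /-- the deceleration parameter -/
  q : ℝ → ℝ
  one_le : 1 ≤ γ
  le_two : γ ≤ 2
  n_pos : ∀ t, τ₀ < t → 0 < n t
  m_lt : ∀ t, τ₀ < t → |m t| < P t
  Ω_pos : ∀ t, τ₀ < t → 0 < Ω t
  constraint : ∀ t, τ₀ < t →
    Ω t = 1 - X t ^ 2 - s t ^ 2 / 3 - m t ^ 2 / 3 - n t ^ 2 / 12 - n t * P t / 3
  q_eq : ∀ t, τ₀ < t → q t = 2 * X t ^ 2 + 2 / 3 * s t ^ 2 + (3 * γ - 2) / 2 * Ω t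
  hasDerivAt_X : ∀ t, τ₀ < t →
    HasDerivAt X (-(2 - q t) * X t - 2 / 3 * m t ^ 2 + n t ^ 2 / 3 + n t * P t / 3) t
  hasDerivAt_s : ∀ t, τ₀ < t → HasDerivAt s (-(2 - q t) * s t - (2 * P t + n t) * m t) t
  hasDerivAt_n : ∀ t, τ₀ < t → HasDerivAt n ((q t - 4 * X t) * n t) t
  hasDerivAt_P : ∀ t, τ₀ < t → HasDerivAt P ((q t + 2 * X t) * P t + 2 * s t * m t) t
  hasDerivAt_m : ∀ t, τ₀ < t → HasDerivAt m ((q t + 2 * X t) * m t + 2 * s t * P t) t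

namespace BianchiVIIIFlow
variable {γ τ₀ : ℝ} (F : BianchiVIIIFlow γ τ₀) {t : ℝ}

theorem P_pos (ht : τ₀ < t) : 0 < F.P t := (abs_nonneg _).trans_lt (F.m_lt t ht)

theorem hasDerivAt_Ω (ht : τ₀ < t) :
    HasDerivAt F.Ω ((2 * F.q t - (3 * γ - 2)) * F.Ω t) t := by
  have h := ((((((hasDerivAt_const t (1 : ℝ)).sub ((F.hasDerivAt_X t ht).pow 2)).sub
    (((F.hasDerivAt_s t ht).pow 2).div_const 3)).sub
    (((F.hasDerivAt_m t ht).pow 2).div_const 3)).sub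
    (((F.hasDerivAt_n t ht).pow 2).div_const 12)).sub
    (((F.hasDerivAt_n t ht).mul (F.hasDerivAt_P t ht)).div_const 3))
  have h' := h.congr_of_eventuallyEq (f₁ := F.Ω) (by
    filter_upwards [Ioi_mem_nhds ht] with u hu
    simp [F.constraint u hu])
  refine h'.congr_deriv ?_
  have h1 := F.q_eq t ht
  have h2 := F.constraint t ht
  simp only [Nat.cast_ofNat]
  rw [h1, h2]
  ring

/-- Every term of the constraint is nonnegative, so that all variables except `P` are bounded. -/
theorem bounds (ht : τ₀ < t) : F.X t ^ 2 ≤ 1 ∧ F.s t ^ 2 + F.m t ^ 2 ≤ 3 ∧ F.n t ^ 2 ≤ 12 ∧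
    F.n t * F.P t ≤ 3 ∧ F.Ω t ≤ 1 ∧ 0 ≤ F.q t ∧ F.q t ≤ 2 ∧
    2 * F.X t ^ 2 + 2 / 3 * F.s t ^ 2 + F.Ω t / 2 ≤ F.q t := by
  have h1 := F.q_eq t ht
  have h2 := F.constraint t ht
  have h3 := F.Ω_pos t ht
  have h4 := mul_pos (F.n_pos t ht) (F.P_pos ht)
  have h5 := F.one_le
  have h6 := F.le_two
  have h7 := mul_nonneg (sub_nonneg.2 h5) h3.le
  have h8 := mul_nonneg (sub_nonneg.2 h6) h3.le
  have x := sq_nonneg (F.X t)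
  have s := sq_nonneg (F.s t)
  have m := sq_nonneg (F.m t)
  have n := sq_nonneg (F.n t)
  refine ⟨?_, ?_, ?_, ?_, ?_, ?_, ?_, ?_⟩ <;> nlinarith

/-- The ratio `m / P = (N₂ - N₃) / (N₂ + N₃)`, which lies in `(-1, 1)`. -/
def w (t : ℝ) : ℝ := F.m t / F.P t

/-- The correction term `s m / P` that averages out the oscillation of `s² - m²`. -/
def c (t : ℝ) : ℝ := F.s t * F.w t

theorem m_eq (ht : τ₀ < t) : F.m t = F.w t * F.P t := by
  rw [w, div_mul_cancel₀ _ (F.P_pos ht).ne']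

theorem abs_w_le (ht : τ₀ < t) : |F.w t| ≤ 1 := by
  rw [w, abs_div, abs_of_pos (F.P_pos ht), div_le_one (F.P_pos ht)]
  exact (F.m_lt t ht).le

theorem hasDerivAt_w (ht : τ₀ < t) : HasDerivAt F.w (2 * F.s t * (1 - F.w t ^ 2)) t := by
  have hP := (F.P_pos ht).ne'
  refine ((F.hasDerivAt_m t ht).div (F.hasDerivAt_P t ht) hP).congr_deriv ?_
  rw [F.m_eq ht]
  field_simp
  ring

/-- The averaging identity: the derivative of `c` is `2 (s² - m²)` up to terms that are small when
`P` is large. -/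
theorem hasDerivAt_c (ht : τ₀ < t) : HasDerivAt F.c
    (2 * (F.s t ^ 2 - F.m t ^ 2) - (2 - F.q t) * F.c t - 2 * F.c t ^ 2
      - F.n t * (F.m t * F.w t)) t := by
  refine ((F.hasDerivAt_s t ht).mul (F.hasDerivAt_w ht)).congr_deriv ?_
  rw [c, F.m_eq ht]
  ring

theorem bdd_X : BoundedAfter τ₀ F.X :=
  ⟨1, fun t ht => abs_le_one_iff_mul_self_le_one.2 (by nlinarith [(F.bounds ht).1])⟩
theorem bdd_s : BoundedAfter τ₀ F.s :=
  ⟨2, fun t ht => abs_le_of_sq_le_sq (by nlinarith [(F.bounds ht).2.1, sq_nonneg (F.m t)])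
    (by norm_num)⟩
theorem bdd_m : BoundedAfter τ₀ F.m :=
  ⟨2, fun t ht => abs_le_of_sq_le_sq (by nlinarith [(F.bounds ht).2.1, sq_nonneg (F.s t)])
    (by norm_num)⟩
theorem bdd_n : BoundedAfter τ₀ F.n :=
  ⟨4, fun t ht => abs_le_of_sq_le_sq (by nlinarith [(F.bounds ht).2.2.1]) (by norm_num)⟩
theorem bdd_nP : BoundedAfter τ₀ (fun t => F.n t * F.P t) :=
  ⟨3, fun t ht => by
    rw [abs_of_pos (mul_pos (F.n_pos t ht) (F.P_pos ht))]; exact (F.bounds ht).2.2.2.1⟩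
theorem bdd_Ω : BoundedAfter τ₀ F.Ω :=
  ⟨1, fun t ht => by rw [abs_of_pos (F.Ω_pos t ht)]; exact (F.bounds ht).2.2.2.2.1⟩
theorem bdd_q : BoundedAfter τ₀ F.q :=
  ⟨2, fun t ht => by
    obtain ⟨-, -, -, -, -, h0, h, -⟩ := F.bounds ht
    rwa [abs_of_nonneg h0]⟩
theorem bdd_w : BoundedAfter τ₀ F.w := ⟨1, fun _ ht => F.abs_w_le ht⟩
theorem bdd_c : BoundedAfter τ₀ F.c := F.bdd_s.mul F.bdd_w

/-- The derivative of `X`. -/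
def dX (t : ℝ) : ℝ :=
  -(2 - F.q t) * F.X t - 2 / 3 * F.m t ^ 2 + F.n t ^ 2 / 3 + F.n t * F.P t / 3

theorem bdd_dX : BoundedAfter τ₀ F.dX :=
  (((((BoundedAfter.const _ 2).sub F.bdd_q).neg.mul F.bdd_X).sub
    ((BoundedAfter.const _ (2 / 3)).mul (F.bdd_m.pow 2))).add
      ((F.bdd_n.pow 2).div_const 3)).add (F.bdd_nP.div_const 3)

theorem dX_eq (ht : τ₀ < t) : F.dX t = -(2 - F.q t) * F.X t + 1 - F.Ω t - F.X t ^ 2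
    - F.s t ^ 2 / 3 - F.m t ^ 2 + F.n t ^ 2 / 4 := by
  rw [dX, F.constraint t ht]; ring

/-! ### Exponential growth of `P` -/

/-- `P` grows at least exponentially. The function `D = n (P² - m²) ≤ 3 P` satisfies `D' = 3 q D`,
and `G = X - c / 2` satisfies `G' ≥ 1/2 - 4 q`; so `log D + (3/4) G` has a derivative of at least
`3/8`, and `G` is bounded. -/
theorem exists_exp_le_P : ∃ k > 0, ∀ t, τ₀ < t → τ₀ + 1 ≤ t →
    k * Real.exp (3 / 8 * t) ≤ F.P t := by
  set ψ : ℝ → ℝ := fun t => Real.log (F.n t * (F.P t ^ 2 - F.m t ^ 2))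
    + 3 / 4 * (F.X t - F.c t / 2) - 3 / 8 * t with hψ
  have hD : ∀ t, τ₀ < t → 0 < F.n t * (F.P t ^ 2 - F.m t ^ 2) := fun t ht =>
    mul_pos (F.n_pos t ht) (sub_pos.2 (sq_lt_sq.2
      ((F.m_lt t ht).trans_eq (abs_of_pos (F.P_pos ht)).symm)))
  have hmono : ∀ t, τ₀ + 1 ≤ t → ψ (τ₀ + 1) ≤ ψ t := by
    intro t h1
    refine le_of_hasDerivAt_nonneg h1 (f' := fun t => 3 * F.q t + 3 / 4 * (F.dX t -
      (2 * (F.s t ^ 2 - F.m t ^ 2) - (2 - F.q t) * F.c t - 2 * F.c t ^ 2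
      - F.n t * (F.m t * F.w t)) / 2) - 3 / 8) (fun u hu _ => ?_) (fun u hu _ => ?_)
    · have hu : τ₀ < u := by linarith
      have d1 := ((F.hasDerivAt_n u hu).mul (((F.hasDerivAt_P u hu).pow 2).sub
        ((F.hasDerivAt_m u hu).pow 2))).log (hD u hu).ne'
      have d2 := (((F.hasDerivAt_X u hu).sub ((F.hasDerivAt_c hu).div_const 2)).const_mul (3 / 4))
      refine ((d1.add d2).sub ((hasDerivAt_id u).const_mul (3 / 8))).congr_deriv ?_
      have := (hD u hu).ne'
      simp only [Pi.mul_apply, Pi.sub_apply, Pi.pow_apply, dX]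
      congr 1
      · congr 1
        rw [div_eq_iff this]
        push_cast
        ring
      · ring
    · have hu : τ₀ < u := by linarith
      have e := F.dX_eq hu
      obtain ⟨b1, b2, b3, b4, b5, b6, b7, b8⟩ := F.bounds hu
      have hw := F.abs_w_le hu
      have c1 : |F.c u| ≤ |F.s u| := by
        rw [c, abs_mul]; exact mul_le_of_le_one_right (abs_nonneg _) hw
      have hnw : 0 ≤ F.n u * (F.m u * F.w u) := by
        rw [F.m_eq hu]
        have := F.n_pos u hu
        have := F.P_pos hu
        have : F.w u * F.P u * F.w u = F.w u ^ 2 * F.P u := by ring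
        rw [this]; positivity
      have c2 : -(1 / 4 + F.s u ^ 2) ≤ (1 - F.q u / 2) * F.c u := by
        have h1 : |(1 - F.q u / 2) * F.c u| ≤ |F.s u| := by
          rw [abs_mul, abs_of_nonneg (by linarith)]
          nlinarith [abs_nonneg (F.c u)]
        have h2 := (abs_le.1 h1).1
        nlinarith [sq_nonneg (|F.s u| - 1 / 2), sq_abs (F.s u)]
      have c3 : -(1 / 4 + 4 * F.X u ^ 2) ≤ -(2 - F.q u) * F.X u := by
        nlinarith [sq_nonneg (F.X u * 2 - (1 - F.q u / 2) / 2), mul_nonneg b6 (sub_nonneg.2 b7)]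
      rw [e]
      linarith [sq_nonneg (F.n u), sq_nonneg (F.c u), sq_nonneg (F.X u), sq_nonneg (F.s u),
        F.Ω_pos u hu]
  refine ⟨Real.exp (ψ (τ₀ + 1) - 3) / 3, by positivity, fun t ht h1 => ?_⟩
  have h := hmono t h1
  obtain ⟨b1, b2, b3, b4, b5, b6, b7, b8⟩ := F.bounds ht
  have hc : |F.c t| ≤ 2 := by
    rw [c, abs_mul]
    have : |F.s t| ≤ 2 := abs_le_of_sq_le_sq (by nlinarith [sq_nonneg (F.m t)]) (by norm_num)
    nlinarith [F.abs_w_le ht, abs_nonneg (F.s t), abs_nonneg (F.w t)]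
  have hX : F.X t ≤ 1 := by nlinarith
  have hl : ψ (τ₀ + 1) - 3 + 3 / 8 * t ≤ Real.log (F.n t * (F.P t ^ 2 - F.m t ^ 2)) := by
    have : ψ t = _ := rfl
    simp only [hψ] at this h ⊢
    linarith [(abs_le.1 hc).1]
  rw [Real.le_log_iff_exp_le (hD t ht), Real.exp_add] at hl
  have hP := F.P_pos ht
  have hn := F.n_pos t ht
  have : F.n t * (F.P t ^ 2 - F.m t ^ 2) ≤ 3 * F.P t := by
    nlinarith [mul_nonneg hn.le (sq_nonneg (F.m t)), mul_le_mul_of_nonneg_right b4 hP.le]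
  linarith

theorem tendsto_P : Tendsto F.P atTop atTop := by
  obtain ⟨k, hk, h⟩ := F.exists_exp_le_P
  refine tendsto_atTop_mono' _ ?_ ((Real.tendsto_exp_atTop.comp
    (tendsto_id.const_mul_atTop (show (0 : ℝ) < 3 / 8 by norm_num))).const_mul_atTop hk)
  filter_upwards [eventually_ge_atTop (τ₀ + 1)] with t ht
  exact h t (by linarith) ht

theorem tendsto_inv_P : Tendsto (fun t => (F.P t)⁻¹) atTop (𝓝 0) :=
  tendsto_inv_atTop_zero.comp F.tendsto_P

theorem tendsto_n : Tendsto F.n atTop (𝓝 0) := by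
  refine (F.bdd_nP.tendsto_mul F.tendsto_inv_P).congr' ?_
  filter_upwards [eventually_gt_atTop τ₀] with t ht
  rw [mul_inv_cancel_right₀ (F.P_pos ht).ne']

theorem tendsto_c : Tendsto F.c atTop (𝓝 0) := by
  refine ((F.bdd_s.mul F.bdd_m).tendsto_mul F.tendsto_inv_P).congr fun t => ?_
  rw [c, w]
  ring

/-! ### The monotone function and the limit of `X` -/

/-- The part of `2 (s² - m²) - c'` that is small when `P` is large. -/
def cRest (t : ℝ) : ℝ :=
  (2 - F.q t) * F.c t + 2 * F.c t ^ 2 + F.n t * (F.m t * F.w t)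

/-- The error in the derivative of `lyapunov` is of order `1 / P`. -/
theorem exists_forall_error_le : ∃ C, 0 ≤ C ∧ ∀ t, τ₀ < t →
    |F.cRest t / (2 * (1 - F.X t / 2)) - F.c t * F.dX t / (4 * (1 - F.X t / 2) ^ 2)|
      ≤ C * (F.P t)⁻¹ := by
  have hy : BoundedAfter τ₀ (fun t => (1 - F.X t / 2)⁻¹) := ⟨2, fun t ht => by
    have : F.X t ≤ 1 := by nlinarith [(F.bounds ht).1]
    rw [abs_of_pos (inv_pos.2 (by linarith)), inv_le_comm₀ (by linarith) (by norm_num)]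
    linarith⟩
  have h2q := (BoundedAfter.const τ₀ 2).sub F.bdd_q
  have hsm := F.bdd_s.mul F.bdd_m
  have hnmw := F.bdd_nP.mul (F.bdd_m.mul F.bdd_w)
  have hR := (((h2q.mul hsm).add ((F.bdd_c.mul hsm).mul (.const τ₀ 2))).add hnmw)
  obtain ⟨C, hC⟩ := ((hR.mul hy).div_const 2).sub (((hsm.mul F.bdd_dX).mul (hy.pow 2)).div_const 4)
  -- `C` bounds the product of the error with `P`, in which `P c = s m` and `P n = n P` are bounded.
  refine ⟨C, (abs_nonneg _).trans (hC (τ₀ + 1) (by linarith)), fun t ht => ?_⟩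
  have hP := F.P_pos ht
  have := mul_le_mul_of_nonneg_right (hC t ht) (inv_nonneg.2 hP.le)
  rw [← abs_of_pos (inv_pos.2 hP), ← abs_mul, abs_of_pos (inv_pos.2 hP)] at this
  refine le_of_eq_of_le ?_ this
  congr 1
  have : 1 - F.X t / 2 ≠ 0 := by nlinarith [(F.bounds ht).1]
  have hsm : F.s t * F.m t = F.c t * F.P t := by rw [c, mul_assoc, ← F.m_eq ht]
  simp only [cRest, hsm]
  field_simp

/-- The logarithm of `n (P² - m²)^{1/2} / (1 - X / 2)²`, with a multiple of `c` subtracted that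
cancels the oscillating term `(s² - m²) / (1 - X / 2)` of its derivative. -/
def lyapunov (t : ℝ) : ℝ := Real.log (F.n t ^ 2 * (F.P t ^ 2 - F.m t ^ 2)) / 2
    - 2 * Real.log (1 - F.X t / 2) - F.c t / (2 * (1 - F.X t / 2))

theorem sq_sub_sq_pos (ht : τ₀ < t) : 0 < F.P t ^ 2 - F.m t ^ 2 :=
  sub_pos.2 (sq_lt_sq.2 ((F.m_lt t ht).trans_eq (abs_of_pos (F.P_pos ht)).symm))

theorem X_le_one (ht : τ₀ < t) : F.X t ≤ 1 := by nlinarith [(F.bounds ht).1]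

theorem hasDerivAt_lyapunov (ht : τ₀ < t) : HasDerivAt F.lyapunov
    (((1 - 2 * F.X t) ^ 2 + 3 * (γ - 1) * F.Ω t + F.n t ^ 2 / 4) / (1 - F.X t / 2)
      + (F.cRest t / (2 * (1 - F.X t / 2))
        - F.c t * F.dX t / (4 * (1 - F.X t / 2) ^ 2))) t := by
  have hX := F.X_le_one ht
  have hy : 1 - F.X t / 2 ≠ 0 := by linarith
  have hPm := (F.sq_sub_sq_pos ht).ne'
  have hn := (F.n_pos t ht).ne'
  have dy := (hasDerivAt_const t (1 : ℝ)).sub ((F.hasDerivAt_X t ht).div_const 2)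
  have d1 := ((((F.hasDerivAt_n t ht).pow 2).mul (((F.hasDerivAt_P t ht).pow 2).sub
        ((F.hasDerivAt_m t ht).pow 2))).log (mul_ne_zero (pow_ne_zero 2 hn) hPm)).div_const 2
  have d2 := (dy.log hy).const_mul 2
  have d3 := (F.hasDerivAt_c ht).div (dy.const_mul 2) (mul_ne_zero two_ne_zero hy)
  refine ((d1.sub d2).sub d3).congr_deriv ?_
  have e1 : (((2 : ℕ) * F.n t ^ (2 - 1) * ((F.q t - 4 * F.X t) * F.n t))
      * (F.P t ^ 2 - F.m t ^ 2) + F.n t ^ 2 *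
      ((2 : ℕ) * F.P t ^ (2 - 1) * ((F.q t + 2 * F.X t) * F.P t + 2 * F.s t * F.m t)
      - (2 : ℕ) * F.m t ^ (2 - 1) * ((F.q t + 2 * F.X t) * F.m t + 2 * F.s t * F.P t)))
      / (F.n t ^ 2 * (F.P t ^ 2 - F.m t ^ 2)) / 2 = 2 * F.q t - 2 * F.X t := by
    field_simp
    push_cast
    ring
  have e2 : F.dX t = -(2 - F.q t) * F.X t - 2 / 3 * F.m t ^ 2 + F.n t ^ 2 / 3
    + F.n t * F.P t / 3 := rfl
  simp only [Pi.mul_apply, Pi.sub_apply, Pi.pow_apply]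
  rw [e1, ← e2]
  have e3 := F.dX_eq ht
  have key : (1 - 2 * F.X t) ^ 2 + 3 * (γ - 1) * F.Ω t + F.n t ^ 2 / 4 + (F.s t ^ 2 - F.m t ^ 2)
      = (2 * F.q t - 2 * F.X t) * (1 - F.X t / 2) + F.dX t := by
    have e4 := F.q_eq t ht
    rw [e3, e4]
    ring
  rw [cRest, eq_sub_of_add_eq key]
  generalize 1 - F.X t / 2 = y at hy ⊢
  field_simp
  ring

theorem lyapunov_le (ht : τ₀ < t) : F.lyapunov t ≤ Real.log 9 / 2 + 2 * Real.log 2 + 2 := by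
  obtain ⟨b1, b2, b3, b4, b5, b6, b7, b8⟩ := F.bounds ht
  have hX := F.X_le_one ht
  have hn := F.n_pos t ht
  have hP := F.P_pos ht
  have h1 : Real.log (F.n t ^ 2 * (F.P t ^ 2 - F.m t ^ 2)) ≤ Real.log 9 := by
    refine Real.log_le_log (mul_pos (pow_pos hn 2) (F.sq_sub_sq_pos ht)) ?_
    nlinarith [mul_pos hn hP, mul_nonneg (sq_nonneg (F.n t)) (sq_nonneg (F.m t))]
  have h2 : -Real.log 2 ≤ Real.log (1 - F.X t / 2) := by
    rw [← Real.log_inv]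
    exact Real.log_le_log (by norm_num) (by linarith)
  have h3 : -(F.c t / (2 * (1 - F.X t / 2))) ≤ 2 := by
    have hc : |F.c t| ≤ 2 := by
      rw [c, abs_mul]
      have : |F.s t| ≤ 2 := abs_le_of_sq_le_sq (by nlinarith [sq_nonneg (F.m t)]) (by norm_num)
      nlinarith [F.abs_w_le ht, abs_nonneg (F.s t), abs_nonneg (F.w t)]
    rw [← neg_div, div_le_iff₀ (by linarith)]
    linarith [(abs_le.1 hc).1]
  rw [lyapunov]
  linarith

/-- `lyapunov` is bounded above and increasing up to an integrable error, so that the nonnegative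
main part of its derivative tends to zero. -/
theorem tendsto_sq_add_Ω :
    Tendsto (fun t => 2 / 3 * (1 - 2 * F.X t) ^ 2 + 2 * (γ - 1) * F.Ω t) atTop (𝓝 0) := by
  obtain ⟨C, hC0, hC⟩ := F.exists_forall_error_le
  obtain ⟨k, hk, hP⟩ := F.exists_exp_le_P
  -- `K` is chosen so that the derivative of `-K exp (-3t/8)` is at least the error bound `C / P`.
  set K := 8 / 3 * C / k with hK
  set M : ℝ → ℝ := fun t => F.lyapunov t - K * Real.exp (-(3 / 8) * t) with hM
  set M' : ℝ → ℝ := fun t => ((1 - 2 * F.X t) ^ 2 + 3 * (γ - 1) * F.Ω t + F.n t ^ 2 / 4)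
      / (1 - F.X t / 2) + (F.cRest t / (2 * (1 - F.X t / 2))
        - F.c t * F.dX t / (4 * (1 - F.X t / 2) ^ 2))
      + C / k * Real.exp (-(3 / 8) * t) with hM'
  have hdM : ∀ t, τ₀ + 1 < t → HasDerivAt M (M' t) t := by
    intro t ht
    have de := ((((hasDerivAt_id t).const_mul (-(3 / 8))).exp).const_mul K)
    refine ((F.hasDerivAt_lyapunov (by linarith)).sub de).congr_deriv ?_
    simp only [hM', hK, id]
    ring
  have hf0 : ∀ t, τ₀ < t → 0 ≤ 2 / 3 * (1 - 2 * F.X t) ^ 2 + 2 * (γ - 1) * F.Ω t := by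
    intro t ht
    have := mul_nonneg (sub_nonneg.2 F.one_le) (F.Ω_pos t ht).le
    nlinarith [sq_nonneg (1 - 2 * F.X t)]
  have hle : ∀ t, τ₀ + 1 < t → 2 / 3 * (1 - 2 * F.X t) ^ 2 + 2 * (γ - 1) * F.Ω t ≤ M' t := by
    intro t h1
    have ht : τ₀ < t := by linarith
    have h2 := (abs_le.1 (hC t ht)).1
    have h3 : (F.P t)⁻¹ ≤ k⁻¹ * Real.exp (-(3 / 8) * t) := by
      rw [neg_mul, Real.exp_neg, ← mul_inv]
      exact inv_anti₀ (by positivity) (hP t ht h1.le)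
    have h4 : C * (F.P t)⁻¹ ≤ C / k * Real.exp (-(3 / 8) * t) := by
      rw [div_eq_mul_inv, mul_assoc]
      exact mul_le_mul_of_nonneg_left h3 hC0
    have hX := F.X_le_one ht
    have hX' : -1 ≤ F.X t := by nlinarith [(F.bounds ht).1]
    have h5 : 2 / 3 * (1 - 2 * F.X t) ^ 2 + 2 * (γ - 1) * F.Ω t ≤
        ((1 - 2 * F.X t) ^ 2 + 3 * (γ - 1) * F.Ω t + F.n t ^ 2 / 4) / (1 - F.X t / 2) := by
      rw [le_div_iff₀ (by linarith)]
      have := hf0 t ht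
      nlinarith [sq_nonneg (F.n t)]
    simp only [hM']
    linarith
  have hmono : MonotoneOn M (Set.Ioi (τ₀ + 1)) := fun x hx y hy hxy =>
    le_of_hasDerivAt_nonneg hxy (fun u hu _ => hdM u (lt_of_lt_of_le hx hu))
      fun u hu _ => (hf0 u (by have : τ₀ + 1 < x := hx; linarith)).trans
        (hle u (lt_of_lt_of_le hx hu))
  have hbdd : ∀ t, τ₀ < t → M t ≤ Real.log 9 / 2 + 2 * Real.log 2 + 2 := fun t ht => by
    have := F.lyapunov_le ht
    have : 0 ≤ K * Real.exp (-(3 / 8) * t) := by positivity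
    simp only [hM]
    linarith
  have hlim : ∃ l, Tendsto M atTop (𝓝 l) := by
    have hm : Monotone (fun t => M (max t (τ₀ + 2))) := fun x y hxy =>
      hmono (lt_of_lt_of_le (show τ₀ + 1 < τ₀ + 2 by linarith) (le_max_right _ _))
        (lt_of_lt_of_le (show τ₀ + 1 < τ₀ + 2 by linarith) (le_max_right _ _))
        (max_le_max_right _ hxy)
    refine ⟨_, (tendsto_atTop_ciSup hm
      ⟨Real.log 9 / 2 + 2 * Real.log 2 + 2, ?_⟩).congr' ?_⟩
    · rintro _ ⟨t, rfl⟩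
      exact hbdd _ (lt_of_lt_of_le (by linarith) (le_max_right _ _))
    · filter_upwards [eventually_ge_atTop (τ₀ + 2)] with t ht
      rw [max_eq_left ht]
  obtain ⟨l, hl⟩ := hlim
  have hdf : BoundedAfter τ₀ (fun t => 2 / 3 * (2 * (1 - 2 * F.X t) * (-2 * F.dX t))
      + 2 * (γ - 1) * ((2 * F.q t - (3 * γ - 2)) * F.Ω t)) :=
    ((BoundedAfter.const _ (2 / 3)).mul (((BoundedAfter.const _ 2).mul
      ((BoundedAfter.const _ 1).sub ((BoundedAfter.const _ 2).mul F.bdd_X))).mul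
      ((BoundedAfter.const _ (-2)).mul F.bdd_dX))).add ((BoundedAfter.const _ _).mul
      ((((BoundedAfter.const _ 2).mul F.bdd_q).sub (.const _ _)).mul F.bdd_Ω))
  obtain ⟨B, hB⟩ := hdf
  refine tendsto_zero_of_le_deriv_add (T := τ₀ + 1) (fun t ht => ?_)
    (fun t ht => hB t (by linarith)) (fun t ht => hf0 t (by linarith)) hdM hl
    (tendsto_const_nhds (x := (0 : ℝ))) (fun t ht => by simpa using hle t ht)
  have ht' : τ₀ < t := by linarith
  have d1 := ((((F.hasDerivAt_X t ht').const_mul 2).const_sub 1).pow 2).const_mul (2 / 3)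
  refine (d1.add ((F.hasDerivAt_Ω ht').const_mul (2 * (γ - 1)))).congr_deriv ?_
  rw [dX]
  norm_num

theorem tendsto_X : Tendsto F.X atTop (𝓝 (1 / 2)) := by
  have h : Tendsto (fun t => (1 - 2 * F.X t) ^ 2) atTop (𝓝 0) := by
    refine squeeze_zero' (Eventually.of_forall fun t => sq_nonneg _) ?_
      (by simpa using F.tendsto_sq_add_Ω.const_mul (3 / 2))
    filter_upwards [eventually_gt_atTop τ₀] with t ht
    have := mul_nonneg (sub_nonneg.2 F.one_le) (F.Ω_pos t ht).le
    linarith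
  have h2 := ((tendsto_zero_iff_abs_tendsto_zero _).2
    (by simpa [Function.comp_def, Real.sqrt_sq_eq_abs] using
      (Real.continuous_sqrt.tendsto 0).comp h) : Tendsto (fun t => 1 - 2 * F.X t) atTop (𝓝 0))
  have h3 := (h2.const_sub 1).div_const 2
  simpa using h3

/-! ### The limits of the shear and of the density parameter -/

theorem tendsto_sub_half : Tendsto (fun t => F.X t - 1 / 2) atTop (𝓝 0) := by
  simpa using F.tendsto_X.sub_const (1 / 2)

/-- The function is the derivative of the convergent function `c / 4 - X`, up to terms that tend to
zero because `X - 1/2`, `c` and `n` do. -/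
theorem tendsto_shear_add_Ω : Tendsto (fun t => (F.s t ^ 2 + F.m t ^ 2) / 2
    + 3 / 4 * (2 - γ) * F.Ω t) atTop (𝓝 0) := by
  have hf0 : ∀ t, τ₀ < t → 0 ≤ (F.s t ^ 2 + F.m t ^ 2) / 2 + 3 / 4 * (2 - γ) * F.Ω t := by
    intro t ht
    have := mul_nonneg (sub_nonneg.2 F.le_two) (F.Ω_pos t ht).le
    nlinarith [sq_nonneg (F.s t), sq_nonneg (F.m t)]
  have hY : Tendsto (fun t => F.c t / 4 - F.X t) atTop (𝓝 (0 / 4 - 1 / 2)) :=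
    (F.tendsto_c.div_const 4).sub F.tendsto_X
  have h2q := (BoundedAfter.const τ₀ 2).sub F.bdd_q
  have hg : Tendsto (fun t => (2 - F.q t) * (F.c t / 4 - (F.X t - 1 / 2)) + F.c t * F.c t / 2
      + F.m t * F.w t * F.n t / 4 + F.n t * F.n t / 4) atTop (𝓝 0) := by
    have h1 := h2q.tendsto_mul (show Tendsto (fun t => F.c t / 4 - (F.X t - 1 / 2)) atTop (𝓝 0) by
      simpa using (F.tendsto_c.div_const 4).sub F.tendsto_sub_half)
    have h2 := F.bdd_c.tendsto_mul F.tendsto_c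
    have h3 := (F.bdd_m.mul F.bdd_w).tendsto_mul F.tendsto_n
    have h4 := F.bdd_n.tendsto_mul F.tendsto_n
    simpa using ((h1.add (h2.div_const 2)).add (h3.div_const 4)).add (h4.div_const 4)
  have hdf : BoundedAfter τ₀ (fun t => -(2 - F.q t) * F.s t ^ 2 - F.n t * (F.s t * F.m t)
      + (F.q t + 2 * F.X t) * F.m t ^ 2
      + 3 / 4 * (2 - γ) * ((2 * F.q t - (3 * γ - 2)) * F.Ω t)) :=
    (((h2q.neg.mul (F.bdd_s.pow 2)).sub (F.bdd_n.mul (F.bdd_s.mul F.bdd_m))).add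
      ((F.bdd_q.add ((BoundedAfter.const _ 2).mul F.bdd_X)).mul (F.bdd_m.pow 2))).add
      ((BoundedAfter.const _ _).mul
        ((((BoundedAfter.const _ 2).mul F.bdd_q).sub (.const _ _)).mul F.bdd_Ω))
  obtain ⟨B, hB⟩ := hdf
  refine tendsto_zero_of_le_deriv_add (T := τ₀) (fun t ht => ?_) hB hf0
    (fun t ht => ((F.hasDerivAt_c ht).div_const 4).sub (F.hasDerivAt_X t ht)) hY hg
    (fun t ht => le_of_eq ?_)
  · refine (((((F.hasDerivAt_s t ht).pow 2).add ((F.hasDerivAt_m t ht).pow 2)).div_const 2).add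
      ((F.hasDerivAt_Ω ht).const_mul (3 / 4 * (2 - γ)))).congr_deriv ?_
    push_cast
    ring
  · have e1 := F.dX_eq ht
    rw [dX] at e1
    rw [e1, F.q_eq t ht]
    ring

theorem tendsto_sq_add_sq : Tendsto (fun t => F.s t ^ 2 + F.m t ^ 2) atTop (𝓝 0) := by
  refine squeeze_zero' (Eventually.of_forall fun t => by positivity) ?_
    (by simpa using F.tendsto_shear_add_Ω.const_mul 2)
  filter_upwards [eventually_gt_atTop τ₀] with t ht
  have := mul_nonneg (sub_nonneg.2 F.le_two) (F.Ω_pos t ht).le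
  linarith

/-- For `γ < 2` this is a consequence of `tendsto_shear_add_Ω`, and for `γ > 1` of
`tendsto_sq_add_Ω`; the sum of the two functions, suitably weighted, dominates `Ω` for every `γ`. -/
theorem tendsto_Ω : Tendsto F.Ω atTop (𝓝 0) := by
  have h := (F.tendsto_shear_add_Ω.const_mul (4 / 3)).add (F.tendsto_sq_add_Ω.div_const 2)
  simp only [mul_zero, zero_div, add_zero] at h
  refine squeeze_zero' ?_ ?_ h
  · filter_upwards [eventually_gt_atTop τ₀] with t ht using (F.Ω_pos t ht).le
  · filter_upwards [eventually_gt_atTop τ₀] with t ht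
    nlinarith [sq_nonneg (F.s t), sq_nonneg (F.m t), sq_nonneg (1 - 2 * F.X t)]

theorem tendsto_s : Tendsto F.s atTop (𝓝 0) := by
  have h : Tendsto (fun t => F.s t ^ 2) atTop (𝓝 0) :=
    squeeze_zero (fun t => sq_nonneg _) (fun t => by nlinarith [sq_nonneg (F.m t)])
      F.tendsto_sq_add_sq
  exact (tendsto_zero_iff_abs_tendsto_zero _).2
    (by simpa [Function.comp_def, Real.sqrt_sq_eq_abs] using
      (Real.continuous_sqrt.tendsto 0).comp h)

theorem tendsto_q : Tendsto F.q atTop (𝓝 (1 / 2)) := by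
  have h := (((F.tendsto_X.pow 2).const_mul 2).add ((F.tendsto_s.pow 2).const_mul (2 / 3))).add
    (F.tendsto_Ω.const_mul ((3 * γ - 2) / 2))
  have e : (2 * (1 / 2) ^ 2 + 2 / 3 * 0 ^ 2 + (3 * γ - 2) / 2 * 0 : ℝ) = 1 / 2 := by norm_num
  rw [e] at h
  refine h.congr' ?_
  filter_upwards [eventually_gt_atTop τ₀] with t ht
  rw [F.q_eq t ht]

/-! ### Growth of `P² (s² + m²)` -/

/-- The oscillation cannot die out in finite time, since `(s² + m²)' ≥ -12 (s² + m²)`. -/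
theorem sq_add_sq_pos {t₁ : ℝ} (h₁ : τ₀ < t₁) (h : 0 < F.s t₁ ^ 2 + F.m t₁ ^ 2) (ht : t₁ ≤ t) :
    0 < F.s t ^ 2 + F.m t ^ 2 := by
  have := le_of_hasDerivAt_nonneg ht (f := fun u => (F.s u ^ 2 + F.m u ^ 2) * Real.exp (12 * u))
    (f' := fun u => ((2 * (F.s u * (-(2 - F.q u) * F.s u - (2 * F.P u + F.n u) * F.m u)
      + F.m u * ((F.q u + 2 * F.X u) * F.m u + 2 * F.s u * F.P u)))
      + 12 * (F.s u ^ 2 + F.m u ^ 2)) * Real.exp (12 * u)) (fun u hu _ => ?_) (fun u hu _ => ?_)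
  · have h2 := (mul_pos h (Real.exp_pos (12 * t₁))).trans_le this
    exact pos_of_mul_pos_left h2 (Real.exp_pos _).le
  · have hu := h₁.trans_le hu
    refine ((((F.hasDerivAt_s u hu).pow 2).add ((F.hasDerivAt_m u hu).pow 2)).mul
      ((hasDerivAt_id u).const_mul 12).exp).congr_deriv ?_
    simp
    ring
  · have hu := h₁.trans_le hu
    refine mul_nonneg ?_ (Real.exp_pos _).le
    obtain ⟨b1, b2, b3, b4, b5, b6, b7, b8⟩ := F.bounds hu
    have hn := F.n_pos u hu
    have hn4 : F.n u ≤ 4 := by nlinarith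
    have hX : -1 ≤ F.X u := by nlinarith
    nlinarith [mul_nonneg b6 (sq_nonneg (F.s u)), mul_nonneg b6 (sq_nonneg (F.m u)),
      mul_nonneg hn.le (sq_nonneg (F.s u - F.m u)),
      mul_nonneg (sub_nonneg.2 hn4) (add_nonneg (sq_nonneg (F.s u)) (sq_nonneg (F.m u))),
      mul_nonneg (sub_nonneg.2 hX) (sq_nonneg (F.m u))]

/-- The function `s² + m²`, corrected so that the oscillating term `2 (1 + X) (m² - s²)` of its
derivative cancels (`c'` contributes `2 (s² - m²)`). -/
def U (t : ℝ) : ℝ := F.s t ^ 2 + F.m t ^ 2 + (1 + F.X t) * F.c t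

/-- The derivative of `U`. -/
def dU (t : ℝ) : ℝ := (2 * F.q t - 2 + 2 * F.X t) * (F.s t ^ 2 + F.m t ^ 2)
  - 2 * F.n t * F.s t * F.m t - (1 + F.X t) * F.cRest t + F.dX t * F.c t

theorem hasDerivAt_U (ht : τ₀ < t) : HasDerivAt F.U (F.dU t) t := by
  refine ((((F.hasDerivAt_s t ht).pow 2).add ((F.hasDerivAt_m t ht).pow 2)).add
    (((F.hasDerivAt_X t ht).const_add 1).mul (F.hasDerivAt_c ht))).congr_deriv ?_
  rw [dU, dX, cRest]
  push_cast
  ring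

theorem abs_c_le (ht : τ₀ < t) : |F.c t| ≤ (F.s t ^ 2 + F.m t ^ 2) * (F.P t)⁻¹ := by
  have hP := inv_pos.2 (F.P_pos ht)
  have : F.c t = F.s t * F.m t * (F.P t)⁻¹ := by rw [c, w]; ring
  rw [this, abs_mul, abs_of_pos hP]
  refine mul_le_mul_of_nonneg_right (abs_le.2 ⟨?_, ?_⟩) hP.le <;>
    nlinarith [sq_nonneg (F.s t + F.m t), sq_nonneg (F.s t - F.m t)]

/-- Late in time, `U` is comparable to `s² + m²`, it decays at most at a small rate, and the
logarithmic derivative `q + 2 X + 2 c` of `P` is at least `1` (its limit is `3/2`). -/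
theorem eventually_U_bounds : ∀ᶠ t in atTop,
    |F.U t - (F.s t ^ 2 + F.m t ^ 2)| ≤ (F.s t ^ 2 + F.m t ^ 2) / 2 ∧
    -(F.s t ^ 2 + F.m t ^ 2) / 4 ≤ F.dU t ∧ 1 ≤ F.q t + 2 * F.X t + 2 * F.c t := by
  have hb : BoundedAfter τ₀ (fun t => F.dX t - (1 + F.X t) * ((2 - F.q t) + 2 * F.c t)) :=
    F.bdd_dX.sub (((BoundedAfter.const _ 1).add F.bdd_X).mul
      (((BoundedAfter.const _ 2).sub F.bdd_q).add ((BoundedAfter.const _ 2).mul F.bdd_c)))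
  have h1 := (hb.tendsto_mul F.tendsto_inv_P).abs.eventually_lt_const
    (show |(0 : ℝ)| < 1 / 24 by norm_num)
  have h2 := F.tendsto_n.eventually_lt_const (show (0 : ℝ) < 1 / 24 by norm_num)
  have h3 := F.tendsto_inv_P.eventually_lt_const (show (0 : ℝ) < 1 / 4 by norm_num)
  have h4 := (((F.tendsto_q.const_mul 2).sub_const 2).add
    (F.tendsto_X.const_mul 2)).eventually_const_lt
    (show -(1 / 24) < (2 * (1 / 2) - 2 + 2 * (1 / 2) : ℝ) by norm_num)
  have h5 := ((F.tendsto_q.add (F.tendsto_X.const_mul 2)).add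
    (F.tendsto_c.const_mul 2)).eventually_const_lt
    (show 1 < (1 / 2 + 2 * (1 / 2) + 2 * 0 : ℝ) by norm_num)
  filter_upwards [h1, h2, h3, h4, h5, eventually_gt_atTop τ₀] with t h1 h2 h3 h4 h5 ht
  obtain ⟨b1, b2, b3, b4, b5, b6, b7, b8⟩ := F.bounds ht
  have hX := F.X_le_one ht
  have hX' : -1 ≤ F.X t := by nlinarith
  have hP := F.P_pos ht
  have hP' := inv_pos.2 hP
  have hn := F.n_pos t ht
  have hc := F.abs_c_le ht
  have hR : 0 ≤ F.s t ^ 2 + F.m t ^ 2 := by positivity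
  have hmw : 0 ≤ F.m t * F.w t ∧ F.m t * F.w t ≤ (F.s t ^ 2 + F.m t ^ 2) / 4 := by
    have e : F.m t * F.w t = F.m t ^ 2 * (F.P t)⁻¹ := by rw [w]; ring
    rw [e]
    refine ⟨by positivity, ?_⟩
    linarith [mul_le_mul_of_nonneg_left h3.le (sq_nonneg (F.m t)), sq_nonneg (F.s t)]
  have hbc : |(F.dX t - (1 + F.X t) * ((2 - F.q t) + 2 * F.c t)) * F.c t|
      ≤ (F.s t ^ 2 + F.m t ^ 2) / 24 := by
    rw [abs_mul]
    rw [abs_mul, abs_of_pos hP'] at h1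
    calc _ ≤ |F.dX t - (1 + F.X t) * ((2 - F.q t) + 2 * F.c t)|
          * ((F.s t ^ 2 + F.m t ^ 2) * (F.P t)⁻¹) := mul_le_mul_of_nonneg_left hc (abs_nonneg _)
      _ = (|F.dX t - (1 + F.X t) * ((2 - F.q t) + 2 * F.c t)| * (F.P t)⁻¹)
          * (F.s t ^ 2 + F.m t ^ 2) := by ring
      _ ≤ 1 / 24 * (F.s t ^ 2 + F.m t ^ 2) := mul_le_mul_of_nonneg_right h1.le hR
      _ = _ := by ring
  refine ⟨?_, ?_, h5.le⟩
  · have : F.U t - (F.s t ^ 2 + F.m t ^ 2) = (1 + F.X t) * F.c t := by rw [U]; ring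
    rw [this, abs_mul, abs_of_nonneg (by linarith)]
    linarith [mul_le_mul_of_nonneg_left h3.le hR,
      mul_le_mul_of_nonneg_right hX (abs_nonneg (F.c t))]
  · have e : F.dU t = (2 * F.q t - 2 + 2 * F.X t) * (F.s t ^ 2 + F.m t ^ 2)
        - F.n t * (2 * F.s t * F.m t) - (1 + F.X t) * F.n t * (F.m t * F.w t)
        + (F.dX t - (1 + F.X t) * ((2 - F.q t) + 2 * F.c t)) * F.c t := by
      rw [dU, cRest]; ring
    have e1 : -(F.s t ^ 2 + F.m t ^ 2) / 24
        ≤ (2 * F.q t - 2 + 2 * F.X t) * (F.s t ^ 2 + F.m t ^ 2) := by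
      linarith [mul_le_mul_of_nonneg_right h4.le hR]
    have e2 : F.n t * (2 * F.s t * F.m t) ≤ (F.s t ^ 2 + F.m t ^ 2) / 24 := by
      linarith [mul_le_mul_of_nonneg_left (two_mul_le_add_sq (F.s t) (F.m t)) hn.le,
        mul_le_mul_of_nonneg_right h2.le hR]
    have e3 : (1 + F.X t) * F.n t * (F.m t * F.w t) ≤ (F.s t ^ 2 + F.m t ^ 2) / 24 := by
      have : (1 + F.X t) * F.n t ≤ 1 / 12 := by
        linarith [mul_le_mul_of_nonneg_right hX hn.le]
      linarith [mul_le_mul this hmw.2 hmw.1 (by norm_num)]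
    rw [e]
    linarith [(abs_le.1 hbc).1]

/-- If the solution is not locally rotationally symmetric, then `P² (s² + m²)` grows without
bound, because `P² U exp (-t/6)` is eventually increasing. -/
theorem tendsto_P_sq_mul {t₁ : ℝ} (h₁ : τ₀ < t₁) (h : 0 < F.s t₁ ^ 2 + F.m t₁ ^ 2) :
    Tendsto (fun t => F.P t ^ 2 * (F.s t ^ 2 + F.m t ^ 2)) atTop atTop := by
  obtain ⟨N, hN⟩ := eventually_atTop.1 F.eventually_U_bounds
  set T := max N t₁ with hT
  have hTt : ∀ t, T ≤ t → t₁ ≤ t ∧ τ₀ < t ∧ N ≤ t := fun t ht =>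
    ⟨(le_max_right _ _).trans ht, h₁.trans_le ((le_max_right _ _).trans ht),
      (le_max_left _ _).trans ht⟩
  have hU : ∀ t, T ≤ t → 0 < F.U t ∧ F.U t ≤ 3 / 2 * (F.s t ^ 2 + F.m t ^ 2) := by
    intro t ht
    obtain ⟨h1, h2, h3⟩ := hTt t ht
    have h4 := abs_le.1 (hN t h3).1
    have h5 := F.sq_add_sq_pos h₁ h h1
    constructor <;> linarith
  have hmono : ∀ t, T ≤ t → F.P T ^ 2 * F.U T * Real.exp (-(1 / 6) * T)
      ≤ F.P t ^ 2 * F.U t * Real.exp (-(1 / 6) * t) := by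
    intro t ht
    refine le_of_hasDerivAt_nonneg ht
      (f := fun t => F.P t ^ 2 * F.U t * Real.exp (-(1 / 6) * t))
      (f' := fun t => F.P t ^ 2 * (2 * (F.q t + 2 * F.X t + 2 * F.c t) * F.U t + F.dU t
        - 1 / 6 * F.U t) * Real.exp (-(1 / 6) * t)) (fun u hu _ => ?_) (fun u hu _ => ?_)
    · obtain ⟨h1, h2, h3⟩ := hTt u hu
      refine ((((F.hasDerivAt_P u h2).pow 2).mul (F.hasDerivAt_U h2)).mul
        ((hasDerivAt_id u).const_mul (-(1 / 6))).exp).congr_deriv ?_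
      have : F.P u ≠ 0 := (F.P_pos h2).ne'
      rw [c, w]
      simp
      field_simp
      ring
    · obtain ⟨h1, h2, h3⟩ := hTt u hu
      obtain ⟨h4, h5, h6⟩ := hN u h3
      obtain ⟨h7, h8⟩ := hU u hu
      have h9 := abs_le.1 h4
      have : 0 ≤ 2 * (F.q u + 2 * F.X u + 2 * F.c u) * F.U u + F.dU u - 1 / 6 * F.U u := by
        nlinarith
      positivity
  have h0 : 0 < F.P T ^ 2 * F.U T * Real.exp (-(1 / 6) * T) := by
    have := (hU T le_rfl).1
    have := F.P_pos (hTt T le_rfl).2.1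
    positivity
  refine tendsto_atTop_mono' _ ?_ ((Real.tendsto_exp_atTop.comp
    (tendsto_id.const_mul_atTop (show (0 : ℝ) < 1 / 6 by norm_num))).const_mul_atTop
    (mul_pos (show (0 : ℝ) < 2 / 3 by norm_num) h0))
  filter_upwards [eventually_ge_atTop T] with t ht
  have h1 := hmono t ht
  have h2 : Real.exp (-(1 / 6) * t) * Real.exp (1 / 6 * t) = 1 := by
    rw [← Real.exp_add]; simp
  have h3 := mul_le_mul_of_nonneg_right h1 (Real.exp_pos (1 / 6 * t)).le
  rw [mul_assoc (F.P t ^ 2 * F.U t), h2, mul_one] at h3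
  have h4 := mul_le_mul_of_nonneg_left (hU t ht).2 (sq_nonneg (F.P t))
  simp only [Function.comp, id]
  linarith

end BianchiVIIIFlow

/-! ### The commutation functions and the connection -/

namespace BianchiVIIISpacetime
variable (S : BianchiVIIISpacetime)

/-- The commutation function `-γ¹₂₃` of the spatial frame; the sign makes it positive. -/
def n1 (τ : ℝ) : ℝ := S.a 0 τ / (S.a 1 τ * S.a 2 τ)

/-- The commutation function `γ²₃₁` of the spatial frame. -/
def n2 (τ : ℝ) : ℝ := S.a 1 τ / (S.a 2 τ * S.a 0 τ)

/-- The commutation function `γ³₁₂` of the spatial frame. -/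
def n3 (τ : ℝ) : ℝ := S.a 2 τ / (S.a 0 τ * S.a 1 τ)

/-- The functions `comm` expressed by `n1`, `n2` and `n3`; as a function of `τ` for each choice of
the indices, so that the derivatives in the curvature apply to them directly. -/
def commTable (a b c : Fin 4) : ℝ → ℝ :=
  match a, b, c with
  | 1, 0, 1 => fun τ => -S.axisRate 0 τ
  | 1, 1, 0 => S.axisRate 0
  | 2, 0, 2 => fun τ => -S.axisRate 1 τ
  | 2, 2, 0 => S.axisRate 1
  | 3, 0, 3 => fun τ => -S.axisRate 2 τ
  | 3, 3, 0 => S.axisRate 2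
  | 1, 2, 3 => fun τ => -S.n1 τ
  | 1, 3, 2 => S.n1
  | 2, 3, 1 => S.n2
  | 2, 1, 3 => fun τ => -S.n2 τ
  | 3, 1, 2 => S.n3
  | 3, 2, 1 => fun τ => -S.n3 τ
  | _, _, _ => fun _ => 0

theorem comm_eq (a b c : Fin 4) : S.comm a b c = S.commTable a b c := by
  funext τ
  fin_cases a <;> fin_cases b <;> fin_cases c <;> rfl

/-- The connection coefficients `Γ^a_{bc}`, as functions of `τ` for each choice of the indices. -/
def connTable (a b c : Fin 4) : ℝ → ℝ :=
  match a, b, c with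
  | 0, 1, 1 => S.axisRate 0
  | 1, 1, 0 => S.axisRate 0
  | 0, 2, 2 => S.axisRate 1
  | 2, 2, 0 => S.axisRate 1
  | 0, 3, 3 => S.axisRate 2
  | 3, 3, 0 => S.axisRate 2
  | 1, 2, 3 => fun τ => (-S.n1 τ - S.n2 τ + S.n3 τ) / 2
  | 3, 2, 1 => fun τ => (S.n1 τ + S.n2 τ - S.n3 τ) / 2
  | 2, 3, 1 => fun τ => (-S.n1 τ + S.n2 τ - S.n3 τ) / 2
  | 1, 3, 2 => fun τ => (S.n1 τ - S.n2 τ + S.n3 τ) / 2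
  | 3, 1, 2 => fun τ => (S.n1 τ + S.n2 τ + S.n3 τ) / 2
  | 2, 1, 3 => fun τ => (-S.n1 τ - S.n2 τ - S.n3 τ) / 2
  | _, _, _ => fun _ => 0

set_option maxHeartbeats 1000000 in
theorem conn_eq (a b c : Fin 4) : S.conn a b c = S.connTable a b c := by
  funext τ
  fin_cases a <;> fin_cases b <;> fin_cases c <;>
    simp [conn, connLow, commLow, comm_eq, commTable, minkowski, connTable] <;> ring

variable {S}

theorem hasDerivAt_a {τ : ℝ} (hτ : S.τ₀ < τ) (i : Fin 3) :
    HasDerivAt (S.a i) (deriv (S.a i) τ) τ :=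
  (((S.a_smooth i).differentiableOn (by norm_num)).differentiableAt
    (Ioi_mem_nhds hτ)).hasDerivAt

theorem hasDerivAt_H {τ : ℝ} (hτ : S.τ₀ < τ) : HasDerivAt S.H (deriv S.H τ) τ :=
  ((S.H_smooth.differentiableOn (by norm_num)).differentiableAt (Ioi_mem_nhds hτ)).hasDerivAt

theorem hasDerivAt_axisRate {τ : ℝ} (hτ : S.τ₀ < τ) (i : Fin 3) :
    HasDerivAt (S.axisRate i) (deriv (S.axisRate i) τ) τ := by
  have h1 : DifferentiableAt ℝ (deriv (S.a i)) τ :=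
    (((S.a_smooth i).deriv_of_isOpen (m := 1) isOpen_Ioi (by norm_num)).differentiableOn
      (by norm_num)).differentiableAt (Ioi_mem_nhds hτ)
  have h : DifferentiableAt ℝ (S.axisRate i) τ :=
    ((hasDerivAt_H hτ).differentiableAt.mul h1).div (hasDerivAt_a hτ i).differentiableAt
      (S.a_pos i τ hτ).ne'
  exact h.hasDerivAt

theorem n1_pos {τ : ℝ} (hτ : S.τ₀ < τ) : 0 < S.n1 τ :=
  div_pos (S.a_pos 0 τ hτ) (mul_pos (S.a_pos 1 τ hτ) (S.a_pos 2 τ hτ))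
theorem n2_pos {τ : ℝ} (hτ : S.τ₀ < τ) : 0 < S.n2 τ :=
  div_pos (S.a_pos 1 τ hτ) (mul_pos (S.a_pos 2 τ hτ) (S.a_pos 0 τ hτ))
theorem n3_pos {τ : ℝ} (hτ : S.τ₀ < τ) : 0 < S.n3 τ :=
  div_pos (S.a_pos 2 τ hτ) (mul_pos (S.a_pos 0 τ hτ) (S.a_pos 1 τ hτ))

theorem hasDerivAt_div_mul {f g h : ℝ → ℝ} {f' g' h' τ : ℝ} (hf : HasDerivAt f f' τ)
    (hg : HasDerivAt g g' τ) (hh : HasDerivAt h h' τ) (f0 : f τ ≠ 0) (g0 : g τ ≠ 0)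
    (h0 : h τ ≠ 0) :
    HasDerivAt (fun t => f t / (g t * h t))
      (f τ / (g τ * h τ) * (f' / f τ - g' / g τ - h' / h τ)) τ := by
  refine (hf.div (hg.mul hh) (mul_ne_zero g0 h0)).congr_deriv ?_
  simp only [Pi.mul_apply]
  field_simp
  ring

theorem hasDerivAt_n1 {τ : ℝ} (hτ : S.τ₀ < τ) : HasDerivAt S.n1
    (S.n1 τ * (S.axisRate 0 τ - S.axisRate 1 τ - S.axisRate 2 τ) / S.H τ) τ := by
  have hH := (S.H_pos τ hτ).ne'
  refine (hasDerivAt_div_mul (hasDerivAt_a hτ 0) (hasDerivAt_a hτ 1) (hasDerivAt_a hτ 2)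
    (S.a_pos 0 τ hτ).ne' (S.a_pos 1 τ hτ).ne' (S.a_pos 2 τ hτ).ne').congr_deriv ?_
  simp only [axisRate, n1]
  field_simp

theorem hasDerivAt_n2 {τ : ℝ} (hτ : S.τ₀ < τ) : HasDerivAt S.n2
    (S.n2 τ * (S.axisRate 1 τ - S.axisRate 2 τ - S.axisRate 0 τ) / S.H τ) τ := by
  have hH := (S.H_pos τ hτ).ne'
  refine (hasDerivAt_div_mul (hasDerivAt_a hτ 1) (hasDerivAt_a hτ 2) (hasDerivAt_a hτ 0)
    (S.a_pos 1 τ hτ).ne' (S.a_pos 2 τ hτ).ne' (S.a_pos 0 τ hτ).ne').congr_deriv ?_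
  simp only [axisRate, n2]
  field_simp

theorem hasDerivAt_n3 {τ : ℝ} (hτ : S.τ₀ < τ) : HasDerivAt S.n3
    (S.n3 τ * (S.axisRate 2 τ - S.axisRate 0 τ - S.axisRate 1 τ) / S.H τ) τ := by
  have hH := (S.H_pos τ hτ).ne'
  refine (hasDerivAt_div_mul (hasDerivAt_a hτ 2) (hasDerivAt_a hτ 0) (hasDerivAt_a hτ 1)
    (S.a_pos 2 τ hτ).ne' (S.a_pos 0 τ hτ).ne' (S.a_pos 1 τ hτ).ne').congr_deriv ?_
  simp only [axisRate, n3]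
  field_simp

theorem sum_axisRate {τ : ℝ} (hτ : S.τ₀ < τ) :
    S.axisRate 0 τ + S.axisRate 1 τ + S.axisRate 2 τ = 3 * S.H τ := by
  have h1 : HasDerivAt (fun t => S.a 0 t * S.a 1 t * S.a 2 t) _ τ :=
    ((hasDerivAt_a hτ 0).mul (hasDerivAt_a hτ 1)).mul (hasDerivAt_a hτ 2)
  have h2 : HasDerivAt (fun t => (S.ℓ₀ * Real.exp t) ^ 3) (3 * (S.ℓ₀ * Real.exp τ) ^ 3) τ := by
    refine (((Real.hasDerivAt_exp τ).const_mul S.ℓ₀).pow 3).congr_deriv ?_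
    simp; ring
  have h3 := (h1.congr_of_eventuallyEq
    (f₁ := fun t => (S.ℓ₀ * Real.exp t) ^ 3) (by
      filter_upwards [Ioi_mem_nhds hτ] with t ht
      exact (S.length_scale t ht).symm)).unique h2
  simp only [Pi.mul_apply] at h3
  rw [← S.length_scale τ hτ] at h3
  have p0 := (S.a_pos 0 τ hτ).ne'
  have p1 := (S.a_pos 1 τ hτ).ne'
  have p2 := (S.a_pos 2 τ hτ).ne'
  simp only [axisRate]
  field_simp
  linear_combination S.H τ * h3

/-! ### Curvature -/

theorem ricci_zero_zero (τ : ℝ) :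
    S.ricci 0 0 τ = -(S.H τ * deriv (S.axisRate 0) τ + S.axisRate 0 τ ^ 2)
      - (S.H τ * deriv (S.axisRate 1) τ + S.axisRate 1 τ ^ 2)
      - (S.H τ * deriv (S.axisRate 2) τ + S.axisRate 2 τ ^ 2) := by
  simp only [ricci, riemann, Fin.sum_univ_four, conn_eq, comm_eq, frameDeriv]
  simp only [connTable, commTable]
  simp
  ring

theorem ricci_one_one (τ : ℝ) :
    S.ricci 1 1 τ = S.H τ * deriv (S.axisRate 0) τ
      + S.axisRate 0 τ * (S.axisRate 0 τ + S.axisRate 1 τ + S.axisRate 2 τ)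
      + (S.n1 τ ^ 2 - (S.n2 τ - S.n3 τ) ^ 2) / 2 := by
  simp only [ricci, riemann, Fin.sum_univ_four, conn_eq, comm_eq, frameDeriv]
  simp only [connTable, commTable]
  simp
  ring

theorem ricci_two_two (τ : ℝ) :
    S.ricci 2 2 τ = S.H τ * deriv (S.axisRate 1) τ
      + S.axisRate 1 τ * (S.axisRate 0 τ + S.axisRate 1 τ + S.axisRate 2 τ)
      + (S.n2 τ ^ 2 - (S.n1 τ + S.n3 τ) ^ 2) / 2 := by
  simp only [ricci, riemann, Fin.sum_univ_four, conn_eq, comm_eq, frameDeriv]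
  simp only [connTable, commTable]
  simp
  ring

theorem ricci_three_three (τ : ℝ) :
    S.ricci 3 3 τ = S.H τ * deriv (S.axisRate 2) τ
      + S.axisRate 2 τ * (S.axisRate 0 τ + S.axisRate 1 τ + S.axisRate 2 τ)
      + (S.n3 τ ^ 2 - (S.n1 τ + S.n2 τ) ^ 2) / 2 := by
  simp only [ricci, riemann, Fin.sum_univ_four, conn_eq, comm_eq, frameDeriv]
  simp only [connTable, commTable]
  simp
  ring

/-- The contraction that defines the dual Weyl tensor, for the index pairs that enter the magnetic
part. The signs are those of `eps4 1 0 2 3 = eps4 2 0 3 1 = eps4 3 0 1 2 = -1`. -/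
theorem sum_eps4_mul (F : Fin 4 → Fin 4 → ℝ) :
    (∑ e, ∑ f, eps4 0 0 e f * minkowski e e * minkowski f f * F e f) = 0 ∧
    (∑ e, ∑ f, eps4 1 0 e f * minkowski e e * minkowski f f * F e f) = F 3 2 - F 2 3 ∧
    (∑ e, ∑ f, eps4 2 0 e f * minkowski e e * minkowski f f * F e f) = F 1 3 - F 3 1 ∧
    (∑ e, ∑ f, eps4 3 0 e f * minkowski e e * minkowski f f * F e f) = F 2 1 - F 1 2 := by
  simp [Fin.sum_univ_four, eps4, minkowski]
  norm_num
  refine ⟨?_, ?_, ?_⟩ <;> ring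

theorem magnetic_eq (b : Fin 4) (τ : ℝ) : S.magnetic 0 b τ = 0 ∧
    S.magnetic 1 b τ = (S.weyl 3 2 b 0 τ - S.weyl 2 3 b 0 τ) / 2 ∧
    S.magnetic 2 b τ = (S.weyl 1 3 b 0 τ - S.weyl 3 1 b 0 τ) / 2 ∧
    S.magnetic 3 b τ = (S.weyl 2 1 b 0 τ - S.weyl 1 2 b 0 τ) / 2 := by
  obtain ⟨h0, h1, h2, h3⟩ := sum_eps4_mul (fun e f => S.weyl e f b 0 τ)
  refine ⟨?_, ?_, ?_, ?_⟩
  · rw [magnetic, dualWeyl, h0, zero_div]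
  · rw [magnetic, dualWeyl, h1]
  · rw [magnetic, dualWeyl, h2]
  · rw [magnetic, dualWeyl, h3]

theorem magnetic_diag {τ : ℝ} (hτ : S.τ₀ < τ) :
    S.magnetic 1 1 τ = (-(2 * S.n1 τ * S.axisRate 0 τ) + S.n1 τ * (S.axisRate 1 τ + S.axisRate 2 τ)
      - (S.axisRate 1 τ - S.axisRate 2 τ) * (S.n2 τ - S.n3 τ)) / 2 ∧
    S.magnetic 2 2 τ = (S.n1 τ * (S.axisRate 0 τ - S.axisRate 2 τ)
      - S.axisRate 0 τ * (S.n2 τ - S.n3 τ) + 2 * S.axisRate 1 τ * S.n2 τ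
      - S.axisRate 2 τ * (S.n2 τ + S.n3 τ)) / 2 ∧
    S.magnetic 3 3 τ = (S.n1 τ * (S.axisRate 0 τ - S.axisRate 1 τ)
      + S.axisRate 0 τ * (S.n2 τ - S.n3 τ) + 2 * S.axisRate 2 τ * S.n3 τ
      - S.axisRate 1 τ * (S.n2 τ + S.n3 τ)) / 2 := by
  have d1 := (hasDerivAt_n1 hτ).differentiableAt
  have d2 := (hasDerivAt_n2 hτ).differentiableAt
  have d3 := (hasDerivAt_n3 hτ).differentiableAt
  have h := (S.H_pos τ hτ).ne'
  rw [(magnetic_eq 1 τ).2.1, (magnetic_eq 2 τ).2.2.1, (magnetic_eq 3 τ).2.2.2]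
  simp only [weyl, riemann, Fin.sum_univ_four, conn_eq, comm_eq, frameDeriv]
  simp only [connTable, commTable]
  simp [minkowski, d1, d2, d3, (hasDerivAt_n1 hτ).deriv, (hasDerivAt_n2 hτ).deriv,
    (hasDerivAt_n3 hτ).deriv]
  refine ⟨?_, ?_, ?_⟩ <;> field_simp <;> ring

theorem electric_diag (τ : ℝ) :
    S.electric 1 1 τ = -(S.H τ * deriv (S.axisRate 0) τ + S.axisRate 0 τ ^ 2)
      - (S.ricci 0 0 τ - S.ricci 1 1 τ) / 2 - S.scalarCurv τ / 6 ∧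
    S.electric 2 2 τ = -(S.H τ * deriv (S.axisRate 1) τ + S.axisRate 1 τ ^ 2)
      - (S.ricci 0 0 τ - S.ricci 2 2 τ) / 2 - S.scalarCurv τ / 6 ∧
    S.electric 3 3 τ = -(S.H τ * deriv (S.axisRate 2) τ + S.axisRate 2 τ ^ 2)
      - (S.ricci 0 0 τ - S.ricci 3 3 τ) / 2 - S.scalarCurv τ / 6 := by
  simp only [electric, weyl, riemann, Fin.sum_univ_four, conn_eq, comm_eq, frameDeriv]
  simp only [connTable, commTable]
  simp [minkowski]
  refine ⟨?_, ?_, ?_⟩ <;> ring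

theorem electric_zero_zero (τ : ℝ) : S.electric 0 0 τ = 0 := by
  simp [electric, weyl, minkowski, riemann, conn_eq, connTable]

variable {γ : ℝ} {μ : ℝ → ℝ}

/-- The off-diagonal field equations, used here instead of a computation of these components. -/
theorem IsPerfectFluid.ricci_eq_zero (hS : S.IsPerfectFluid γ μ) {τ : ℝ} (hτ : S.τ₀ < τ)
    {a b : Fin 4} (h : a ≠ b) : S.ricci a b τ = 0 := by
  have h1 := hS τ hτ a b
  have h2 : ¬ (a = 0 ∧ b = 0) := fun h3 => h (h3.1.trans h3.2.symm)
  simpa [einstein, proj, minkowski, h, h2] using h1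

set_option maxHeartbeats 1000000 in
theorem IsPerfectFluid.magnetic_eq_zero (hS : S.IsPerfectFluid γ μ) {τ : ℝ} (hτ : S.τ₀ < τ)
    {a b : Fin 4} (h : a ≠ b) : S.magnetic a b τ = 0 := by
  have r : ∀ {a b : Fin 4}, a ≠ b → S.ricci a b τ = 0 := fun h => hS.ricci_eq_zero hτ h
  fin_cases a <;> fin_cases b <;> first | exact absurd rfl h |
    (simp only [Fin.mk_one, Fin.reduceFinMk, Fin.zero_eta, magnetic_eq, weyl, riemann,
       Fin.sum_univ_four, conn_eq, comm_eq, frameDeriv]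
     try simp only [connTable, commTable]
     try simp [minkowski, r])

set_option maxHeartbeats 1000000 in
theorem IsPerfectFluid.electric_eq_zero (hS : S.IsPerfectFluid γ μ) {τ : ℝ} (hτ : S.τ₀ < τ)
    {a b : Fin 4} (h : a ≠ b) : S.electric a b τ = 0 := by
  have r : ∀ {a b : Fin 4}, a ≠ b → S.ricci a b τ = 0 := fun h => hS.ricci_eq_zero hτ h
  fin_cases a <;> fin_cases b <;> first | exact absurd rfl h |
    (simp only [Fin.mk_one, Fin.reduceFinMk, Fin.zero_eta, electric, weyl, riemann,
       Fin.sum_univ_four, conn_eq, comm_eq, frameDeriv]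
     simp only [connTable, commTable]
     simp [minkowski, r])

/-- The diagonal field equations, solved for the Ricci tensor. -/
theorem IsPerfectFluid.ricci_diag (hS : S.IsPerfectFluid γ μ) {τ : ℝ} (hτ : S.τ₀ < τ) :
    S.ricci 0 0 τ = (3 * γ - 2) / 2 * μ τ ∧ S.ricci 1 1 τ = (2 - γ) / 2 * μ τ ∧
    S.ricci 2 2 τ = (2 - γ) / 2 * μ τ ∧ S.ricci 3 3 τ = (2 - γ) / 2 * μ τ ∧
    S.scalarCurv τ = (4 - 3 * γ) * μ τ := by
  have h0 := hS τ hτ 0 0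
  have h1 := hS τ hτ 1 1
  have h2 := hS τ hτ 2 2
  have h3 := hS τ hτ 3 3
  simp [einstein, proj, minkowski] at h0 h1 h2 h3
  have h4 : S.scalarCurv τ = -S.ricci 0 0 τ + S.ricci 1 1 τ + S.ricci 2 2 τ + S.ricci 3 3 τ := by
    simp [scalarCurv, minkowski, Fin.sum_univ_four]
  refine ⟨?_, ?_, ?_, ?_, ?_⟩ <;> linarith

theorem shear_eq {τ : ℝ} (hτ : S.τ₀ < τ) (a b : Fin 4) : S.shear a b τ =
    !![0, 0, 0, 0; 0, S.axisRate 0 τ - S.H τ, 0, 0; 0, 0, S.axisRate 1 τ - S.H τ, 0;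
      0, 0, 0, S.axisRate 2 τ - S.H τ] a b := by
  have h := sum_axisRate hτ
  have hc : ∀ a b c, S.connLow a b c τ = minkowski a a * S.connTable a b c τ := by
    intro a b c
    rw [← conn_eq, conn, ← mul_assoc]
    simp only [minkowski]
    split_ifs <;> simp_all
  fin_cases a <;> fin_cases b <;>
    simp [shear, expansion, gradU, hc, connTable, minkowski, proj, Fin.sum_univ_four] <;> linarith

end BianchiVIIISpacetime

/-! ### Hubble-normalized variables of a spacetime -/

namespace BianchiVIIISpacetime
variable {S : BianchiVIIISpacetime} {γ : ℝ} {μ : ℝ → ℝ}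

/-- The variable `Σ₊ = -σ₁₁ / (2 H)`. -/
def X (S : BianchiVIIISpacetime) (τ : ℝ) : ℝ := (1 - S.axisRate 0 τ / S.H τ) / 2

/-- The variable `√3 Σ₋ = (σ₂₂ - σ₃₃) / (2 H)`. -/
def s (S : BianchiVIIISpacetime) (τ : ℝ) : ℝ := (S.axisRate 1 τ - S.axisRate 2 τ) / (2 * S.H τ)

/-- The variable `-N₁`. -/
def n (S : BianchiVIIISpacetime) (τ : ℝ) : ℝ := S.n1 τ / S.H τ

/-- The variable `N₊ = (N₂ + N₃) / 2`. -/
def P (S : BianchiVIIISpacetime) (τ : ℝ) : ℝ := (S.n2 τ + S.n3 τ) / (2 * S.H τ)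

/-- The variable `√3 N₋ = (N₂ - N₃) / 2`. -/
def m (S : BianchiVIIISpacetime) (τ : ℝ) : ℝ := (S.n2 τ - S.n3 τ) / (2 * S.H τ)

/-- The deceleration parameter, in the form that the field equations give it. That it is
`-(1 + H'/H)` is `IsPerfectFluid.hasDerivAt_hubble`. -/
def q (S : BianchiVIIISpacetime) (γ : ℝ) (μ : ℝ → ℝ) (τ : ℝ) : ℝ :=
  2 * S.X τ ^ 2 + 2 / 3 * S.s τ ^ 2 + (3 * γ - 2) / 2 * S.densityParameter μ τ

theorem axisRate_eq {τ : ℝ} (hτ : S.τ₀ < τ) : S.axisRate 0 τ = S.H τ * (1 - 2 * S.X τ) ∧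
    S.axisRate 1 τ = S.H τ * (1 + S.X τ + S.s τ) ∧
    S.axisRate 2 τ = S.H τ * (1 + S.X τ - S.s τ) := by
  have h := (S.H_pos τ hτ).ne'
  have h1 := sum_axisRate hτ
  simp only [X, s]
  refine ⟨by field_simp; ring, ?_, ?_⟩ <;> field_simp <;> linarith

theorem commutation_eq {τ : ℝ} (hτ : S.τ₀ < τ) : S.n1 τ = S.H τ * S.n τ ∧
    S.n2 τ = S.H τ * (S.P τ + S.m τ) ∧ S.n3 τ = S.H τ * (S.P τ - S.m τ) := by
  have h := (S.H_pos τ hτ).ne'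
  simp only [n, P, m]
  refine ⟨?_, ?_, ?_⟩ <;> field_simp <;> ring

theorem density_eq {τ : ℝ} (hτ : S.τ₀ < τ) :
    μ τ = 3 * S.H τ ^ 2 * S.densityParameter μ τ := by
  have h := (S.H_pos τ hτ).ne'
  rw [densityParameter]
  field_simp

/-- The spatial diagonal field equations, as evolution equations for the expansion rates. -/
theorem IsPerfectFluid.deriv_axisRate (hS : S.IsPerfectFluid γ μ) {τ : ℝ} (hτ : S.τ₀ < τ) :
    deriv (S.axisRate 0) τ = S.H τ * (3 / 2 * (2 - γ) * S.densityParameter μ τ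
      - 3 * (1 - 2 * S.X τ) - (S.n τ ^ 2 - 4 * S.m τ ^ 2) / 2) ∧
    deriv (S.axisRate 1) τ = S.H τ * (3 / 2 * (2 - γ) * S.densityParameter μ τ
      - 3 * (1 + S.X τ + S.s τ) - ((S.P τ + S.m τ) ^ 2 - (S.n τ + S.P τ - S.m τ) ^ 2) / 2) ∧
    deriv (S.axisRate 2) τ = S.H τ * (3 / 2 * (2 - γ) * S.densityParameter μ τ
      - 3 * (1 + S.X τ - S.s τ) - ((S.P τ - S.m τ) ^ 2 - (S.n τ + S.P τ + S.m τ) ^ 2) / 2) := by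
  have h := (S.H_pos τ hτ).ne'
  obtain ⟨-, r1, r2, r3, -⟩ := hS.ricci_diag hτ
  rw [ricci_one_one, sum_axisRate hτ] at r1
  rw [ricci_two_two, sum_axisRate hτ] at r2
  rw [ricci_three_three, sum_axisRate hτ] at r3
  obtain ⟨a0, a1, a2⟩ := axisRate_eq hτ
  obtain ⟨c1, c2, c3⟩ := commutation_eq hτ
  rw [a0, c1, c2, c3, density_eq (μ := μ) hτ] at r1
  rw [a1, c1, c2, c3, density_eq (μ := μ) hτ] at r2
  rw [a2, c1, c2, c3, density_eq (μ := μ) hτ] at r3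
  refine ⟨mul_left_cancel₀ h ?_, mul_left_cancel₀ h ?_, mul_left_cancel₀ h ?_⟩
  · linear_combination r1
  · linear_combination r2
  · linear_combination r3

/-- The Hamiltonian constraint. -/
theorem IsPerfectFluid.constraint (hS : S.IsPerfectFluid γ μ) {τ : ℝ} (hτ : S.τ₀ < τ) :
    S.densityParameter μ τ = 1 - S.X τ ^ 2 - S.s τ ^ 2 / 3 - S.m τ ^ 2 / 3 - S.n τ ^ 2 / 12
      - S.n τ * S.P τ / 3 := by
  have h := (S.H_pos τ hτ).ne'
  obtain ⟨r0, -, -, -, -⟩ := hS.ricci_diag hτ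
  obtain ⟨d0, d1, d2⟩ := hS.deriv_axisRate hτ
  obtain ⟨a0, a1, a2⟩ := axisRate_eq hτ
  rw [ricci_zero_zero, a0, a1, a2, d0, d1, d2, density_eq (μ := μ) hτ] at r0
  refine mul_left_cancel₀ (pow_ne_zero 2 h) ?_
  linear_combination -r0 / 6

/-- The Raychaudhuri equation. -/
theorem IsPerfectFluid.hasDerivAt_hubble (hS : S.IsPerfectFluid γ μ) {τ : ℝ} (hτ : S.τ₀ < τ) :
    HasDerivAt S.H (-(1 + S.q γ μ τ) * S.H τ) τ := by
  obtain ⟨d0, d1, d2⟩ := hS.deriv_axisRate hτ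
  have h1 := (((hasDerivAt_axisRate hτ 0).add (hasDerivAt_axisRate hτ 1)).add
    (hasDerivAt_axisRate hτ 2)).div_const 3
  have h2 := h1.congr_of_eventuallyEq (f₁ := S.H) (by
    filter_upwards [Ioi_mem_nhds hτ] with t ht
    simp [sum_axisRate ht])
  refine h2.congr_deriv ?_
  rw [d0, d1, d2, q, hS.constraint hτ]
  ring

/-- The solution of the Hubble-normalized equations that a perfect fluid spacetime defines. -/
def flow (hγ₁ : 1 ≤ γ) (hγ₂ : γ ≤ 2) (hμ : ∀ τ, S.τ₀ < τ → 0 < μ τ)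
    (hS : S.IsPerfectFluid γ μ) : BianchiVIIIFlow γ S.τ₀ where
  X := S.X
  s := S.s
  n := S.n
  P := S.P
  m := S.m
  Ω := S.densityParameter μ
  q := S.q γ μ
  one_le := hγ₁
  le_two := hγ₂
  n_pos τ hτ := div_pos (n1_pos hτ) (S.H_pos τ hτ)
  m_lt τ hτ := by
    have h := S.H_pos τ hτ
    have h2 := n2_pos hτ
    have h3 := n3_pos hτ
    rw [m, P, abs_div, abs_of_pos (show 0 < 2 * S.H τ by linarith)]
    refine div_lt_div_of_pos_right (abs_lt.2 ⟨?_, ?_⟩) (by linarith) <;> linarith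
  Ω_pos τ hτ := div_pos (hμ τ hτ) (by have := S.H_pos τ hτ; positivity)
  constraint τ hτ := hS.constraint hτ
  q_eq τ hτ := rfl
  hasDerivAt_X τ hτ := by
    have h := (S.H_pos τ hτ).ne'
    obtain ⟨d0, d1, d2⟩ := hS.deriv_axisRate hτ
    obtain ⟨a0, a1, a2⟩ := axisRate_eq hτ
    refine ((((hasDerivAt_axisRate hτ 0).div (hS.hasDerivAt_hubble hτ) h).const_sub 1).div_const
      2).congr_deriv ?_
    rw [d0, a0]
    field_simp
    rw [q, hS.constraint hτ]
    ring
  hasDerivAt_s τ hτ := by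
    have h := (S.H_pos τ hτ).ne'
    obtain ⟨d0, d1, d2⟩ := hS.deriv_axisRate hτ
    obtain ⟨a0, a1, a2⟩ := axisRate_eq hτ
    refine (((hasDerivAt_axisRate hτ 1).sub (hasDerivAt_axisRate hτ 2)).div
      ((hS.hasDerivAt_hubble hτ).const_mul 2) (mul_ne_zero two_ne_zero h)).congr_deriv ?_
    simp only [Pi.sub_apply]
    rw [d1, d2, a1, a2]
    field_simp
    ring
  hasDerivAt_n τ hτ := by
    have h := (S.H_pos τ hτ).ne'
    obtain ⟨a0, a1, a2⟩ := axisRate_eq hτ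
    obtain ⟨c1, c2, c3⟩ := commutation_eq hτ
    refine ((hasDerivAt_n1 hτ).div (hS.hasDerivAt_hubble hτ) h).congr_deriv ?_
    rw [a0, a1, a2, c1]
    field_simp
    ring
  hasDerivAt_P τ hτ := by
    have h := (S.H_pos τ hτ).ne'
    obtain ⟨a0, a1, a2⟩ := axisRate_eq hτ
    obtain ⟨c1, c2, c3⟩ := commutation_eq hτ
    refine (((hasDerivAt_n2 hτ).add (hasDerivAt_n3 hτ)).div
      ((hS.hasDerivAt_hubble hτ).const_mul 2) (mul_ne_zero two_ne_zero h)).congr_deriv ?_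
    simp only [Pi.add_apply]
    rw [a0, a1, a2, c2, c3]
    field_simp
    ring
  hasDerivAt_m τ hτ := by
    have h := (S.H_pos τ hτ).ne'
    obtain ⟨a0, a1, a2⟩ := axisRate_eq hτ
    obtain ⟨c1, c2, c3⟩ := commutation_eq hτ
    refine (((hasDerivAt_n2 hτ).sub (hasDerivAt_n3 hτ)).div
      ((hS.hasDerivAt_hubble hτ).const_mul 2) (mul_ne_zero two_ne_zero h)).congr_deriv ?_
    simp only [Pi.sub_apply]
    rw [a0, a1, a2, c2, c3]
    field_simp
    ring

theorem shearParameter_eq {τ : ℝ} (hτ : S.τ₀ < τ) :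
    S.shearParameter τ = √(S.X τ ^ 2 + S.s τ ^ 2 / 3) := by
  have h := (S.H_pos τ hτ).ne'
  obtain ⟨a0, a1, a2⟩ := axisRate_eq hτ
  rw [shearParameter]
  congr 1
  simp [shear_eq hτ, Fin.sum_univ_four, minkowski, a0, a1, a2]
  field_simp
  ring

theorem sigmaMinus_eq {τ : ℝ} (hτ : S.τ₀ < τ) : S.sigmaMinus τ = S.s τ / √3 := by
  have h := (S.H_pos τ hτ).ne'
  rw [sigmaMinus, s]
  simp [shear_eq hτ]
  field_simp

theorem NMinus_eq {τ : ℝ} : S.NMinus τ = S.m τ / √3 := by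
  rw [NMinus, m, comm_eq, comm_eq]
  simp only [commTable]
  field_simp

theorem isLRS_iff : S.IsLRS ↔ ∀ τ, S.τ₀ < τ → S.s τ ^ 2 + S.m τ ^ 2 = 0 := by
  refine forall_congr' fun τ => forall_congr' fun hτ => ?_
  rw [sigmaMinus_eq hτ, NMinus_eq, add_eq_zero_iff_of_nonneg (sq_nonneg _) (sq_nonneg _)]
  simp

/-! ### The Weyl parameter -/

theorem IsPerfectFluid.electric_eq (hS : S.IsPerfectFluid γ μ) {τ : ℝ} (hτ : S.τ₀ < τ) :
    S.electric 1 1 τ = S.H τ ^ 2 * (2 - 2 * S.X τ - 4 * S.X τ ^ 2 + S.n τ ^ 2 / 2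
      - 2 * S.m τ ^ 2 - 2 * S.densityParameter μ τ) ∧
    S.electric 2 2 τ + S.electric 3 3 τ = -S.electric 1 1 τ ∧
    S.electric 2 2 τ - S.electric 3 3 τ =
      S.H τ ^ 2 * (4 * (S.P τ * S.m τ) + ((2 - 4 * S.X τ) * S.s τ + 2 * S.n τ * S.m τ)) := by
  obtain ⟨r0, r1, r2, r3, r⟩ := hS.ricci_diag hτ
  obtain ⟨d0, d1, d2⟩ := hS.deriv_axisRate hτ
  obtain ⟨a0, a1, a2⟩ := axisRate_eq hτ
  obtain ⟨e1, e2, e3⟩ := S.electric_diag τ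
  rw [e1, e2, e3, r0, r1, r2, r3, r, d0, d1, d2, a0, a1, a2, density_eq (μ := μ) hτ]
  have := hS.constraint hτ
  refine ⟨by ring, ?_, by ring⟩
  rw [this]
  ring

theorem magnetic_eq_normalized {τ : ℝ} (hτ : S.τ₀ < τ) :
    S.magnetic 1 1 τ = S.H τ ^ 2 * (3 * S.n τ * S.X τ - 2 * S.s τ * S.m τ) ∧
    S.magnetic 2 2 τ + S.magnetic 3 3 τ = -S.magnetic 1 1 τ ∧
    S.magnetic 2 2 τ - S.magnetic 3 3 τ =
      S.H τ ^ 2 * (4 * (S.P τ * S.s τ) + (S.n τ * S.s τ + 6 * S.X τ * S.m τ)) := by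
  obtain ⟨a0, a1, a2⟩ := axisRate_eq hτ
  obtain ⟨c1, c2, c3⟩ := commutation_eq hτ
  obtain ⟨e1, e2, e3⟩ := magnetic_diag hτ
  rw [e1, e2, e3, a0, a1, a2, c1, c2, c3]
  refine ⟨by ring, by ring, by ring⟩

theorem IsPerfectFluid.weylParameter_eq (hS : S.IsPerfectFluid γ μ) {τ : ℝ} (hτ : S.τ₀ < τ) :
    S.weylParameter τ = √((2 - 2 * S.X τ - 4 * S.X τ ^ 2 + S.n τ ^ 2 / 2
      - 2 * S.m τ ^ 2 - 2 * S.densityParameter μ τ) ^ 2 / 4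
      + (3 * S.n τ * S.X τ - 2 * S.s τ * S.m τ) ^ 2 / 4
      + (4 * (S.P τ * S.m τ) + ((2 - 4 * S.X τ) * S.s τ + 2 * S.n τ * S.m τ)) ^ 2 / 12
      + (4 * (S.P τ * S.s τ) + (S.n τ * S.s τ + 6 * S.X τ * S.m τ)) ^ 2 / 12) := by
  have h := (S.H_pos τ hτ).ne'
  obtain ⟨e1, e2, e3⟩ := hS.electric_eq hτ
  obtain ⟨b1, b2, b3⟩ := magnetic_eq_normalized hτ
  rw [weylParameter]
  congr 1
  have e : ∀ {a b : Fin 4}, a ≠ b → S.electric a b τ = 0 := fun h => hS.electric_eq_zero hτ h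
  have b : ∀ {a b : Fin 4}, a ≠ b → S.magnetic a b τ = 0 := fun h => hS.magnetic_eq_zero hτ h
  simp [Fin.sum_univ_four, minkowski, e, b, electric_zero_zero, (S.magnetic_eq 0 τ).1]
  rw [div_eq_iff (by positivity)]
  generalize S.electric 1 1 τ = x1 at *
  generalize S.electric 2 2 τ = x2 at *
  generalize S.electric 3 3 τ = x3 at *
  generalize S.magnetic 1 1 τ = y1 at *
  generalize S.magnetic 2 2 τ = y2 at *
  generalize S.magnetic 3 3 τ = y3 at *
  -- The sum and the difference of the last two diagonal components are the known ones.
  have i1 : x1 ^ 2 + y1 ^ 2 + (x2 ^ 2 + y2 ^ 2) + (x3 ^ 2 + y3 ^ 2) = (x1 ^ 2 + y1 ^ 2)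
    + ((x2 + x3) ^ 2 + (x2 - x3) ^ 2 + (y2 + y3) ^ 2 + (y2 - y3) ^ 2) / 2 := by ring
  rw [i1, e2, e3, b2, b3, e1, b1]
  ring

end BianchiVIIISpacetime

end

theorem corollary1 (γ : ℝ) (hγ₁ : 1 ≤ γ) (hγ₂ : γ ≤ 2) (S : BianchiVIIISpacetime) (μ : ℝ → ℝ)
    (hμ : ∀ τ, S.τ₀ < τ → 0 < μ τ) (hS : S.IsPerfectFluid γ μ) :
    Tendsto S.shearParameter atTop (𝓝 (1 / 2)) ∧
    Tendsto (S.densityParameter μ) atTop (𝓝 0) ∧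
    (¬ S.IsLRS → Tendsto S.weylParameter atTop atTop) ∧
    (S.IsLRS → Tendsto S.weylParameter atTop (𝓝 0)) := by
  set F := BianchiVIIISpacetime.flow hγ₁ hγ₂ hμ hS
  have hX : Tendsto S.X atTop (𝓝 (1 / 2)) := F.tendsto_X
  have hs : Tendsto S.s atTop (𝓝 0) := F.tendsto_s
  have hn : Tendsto S.n atTop (𝓝 0) := F.tendsto_n
  have hΩ : Tendsto (S.densityParameter μ) atTop (𝓝 0) := F.tendsto_Ω
  refine ⟨?_, hΩ, fun hL => ?_, fun hL => ?_⟩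
  · have h := (Real.continuous_sqrt.tendsto _).comp ((hX.pow 2).add ((hs.pow 2).div_const 3))
    have e : √((1 / 2) ^ 2 + 0 ^ 2 / 3) = 1 / 2 := by
      rw [zero_pow two_ne_zero, zero_div, add_zero, Real.sqrt_sq (by norm_num)]
    rw [e] at h
    refine h.congr' ?_
    filter_upwards [eventually_gt_atTop S.τ₀] with τ hτ
    rw [BianchiVIIISpacetime.shearParameter_eq hτ]
    rfl
  · rw [BianchiVIIISpacetime.isLRS_iff] at hL
    push Not at hL
    obtain ⟨τ₁, h₁, h⟩ := hL
    have hPR : Tendsto (fun τ => S.P τ ^ 2 * (S.s τ ^ 2 + S.m τ ^ 2)) atTop atTop :=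
      F.tendsto_P_sq_mul h₁ (lt_of_le_of_ne (by positivity) h.symm)
    obtain ⟨C, hC⟩ : BoundedAfter S.τ₀ (fun τ => ((2 - 4 * S.X τ) * S.s τ + 2 * S.n τ * S.m τ) ^ 2
        + (S.n τ * S.s τ + 6 * S.X τ * S.m τ) ^ 2) :=
      ((((BoundedAfter.const _ 2).sub ((BoundedAfter.const _ 4).mul F.bdd_X)).mul F.bdd_s).add
        (((BoundedAfter.const _ 2).mul F.bdd_n).mul F.bdd_m)).pow 2 |>.add
        (((F.bdd_n.mul F.bdd_s).add (((BoundedAfter.const _ 6).mul F.bdd_X).mul F.bdd_m)).pow 2)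
    refine tendsto_atTop_mono' _ ?_ (Real.tendsto_sqrt_atTop.comp
      (tendsto_atTop_add_const_right _ (-C / 12)
        (hPR.const_mul_atTop (show (0 : ℝ) < 2 / 3 by norm_num))))
    filter_upwards [eventually_gt_atTop S.τ₀] with τ hτ
    rw [hS.weylParameter_eq hτ]
    refine Real.sqrt_le_sqrt ?_
    have h2 := (abs_le.1 (hC τ hτ)).2
    beta_reduce at h2 ⊢
    have key : ∀ x y : ℝ, x ^ 2 / 2 - y ^ 2 ≤ (x + y) ^ 2 := fun x y => by
      nlinarith [sq_nonneg (x + 2 * y)]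
    have k1 := key (4 * (S.P τ * S.m τ)) ((2 - 4 * S.X τ) * S.s τ + 2 * S.n τ * S.m τ)
    have k2 := key (4 * (S.P τ * S.s τ)) (S.n τ * S.s τ + 6 * S.X τ * S.m τ)
    have k3 := sq_nonneg (2 - 2 * S.X τ - 4 * S.X τ ^ 2 + S.n τ ^ 2 / 2
      - 2 * S.m τ ^ 2 - 2 * S.densityParameter μ τ)
    have k4 := sq_nonneg (3 * S.n τ * S.X τ - 2 * S.s τ * S.m τ)
    have k5 : S.P τ ^ 2 * (S.s τ ^ 2 + S.m τ ^ 2)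
      = (S.P τ * S.m τ) ^ 2 + (S.P τ * S.s τ) ^ 2 := by ring
    rw [k5]
    linarith
  · rw [BianchiVIIISpacetime.isLRS_iff] at hL
    have h := (Real.continuous_sqrt.tendsto _).comp
      (((((((hX.const_mul 2).const_sub 2).sub ((hX.pow 2).const_mul 4)).add
        ((hn.pow 2).div_const 2)).sub (hΩ.const_mul 2)).pow 2 |>.div_const 4).add
        ((((hn.const_mul 3).mul hX).pow 2).div_const 4))
    have e : √((2 - 2 * (1 / 2) - 4 * (1 / 2) ^ 2 + 0 ^ 2 / 2 - 2 * 0) ^ 2 / 4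
        + (3 * 0 * (1 / 2)) ^ 2 / 4) = 0 := by norm_num
    rw [e] at h
    refine h.congr' ?_
    filter_upwards [eventually_gt_atTop S.τ₀] with τ hτ
    have h0 := hL τ hτ
    have hm0 : S.m τ = 0 := by nlinarith [sq_nonneg (S.s τ), sq_nonneg (S.m τ)]
    have hs0 : S.s τ = 0 := by nlinarith [sq_nonneg (S.s τ), sq_nonneg (S.m τ)]
    rw [hS.weylParameter_eq hτ, hm0, hs0]
    simp only [Function.comp]
    congr 1
    ring
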